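/- Let $E$ be a countable set and let $R:E\times E\to\mathbb R$ satisfy $R(\eta,\xi)\ge 0$ for $\eta\ne\xi$, $-\infty<R(\eta,\eta)<0$ and $\sum_{\xi\in E}R(\eta,\xi)=0$ for all $\eta\in E$. Put $\lambda(\eta)=-R(\eta,\eta)$, $p(\eta,\xi)=R(\eta,\xi)/\lambda(\eta)$ for $\eta\neq\xi$ and $p(\eta,\eta)=0$. Assume that the discrete time Markov chain with transition probabilities $p$ is irreducible and recurrent. Let $\mathbf P_\eta$ (with expectation $\mathbf E_\eta$) be the probability measure under which $Y=(Y_n)_{n\ge 0}$ is this chain started from $\eta$ and $(e_n)_{n\ge0}$ are i.i.d. mean one exponential random variables independent of $Y$, and let $\eta_t=Y_{\alpha(t)}$, where $\alpha(t)=\min\{n\ge 0:\sum_{i=0}^n e_i/\lambda(Y_i)>t\}$, be the associated continuous time Markov chain. Assume that $(\eta_t)_{t\ge0}$ is positive recurrent and let $\mu$ be its invariant probability measure. For $\xi\in E$ let $T_\xi=\inf\{t>0:\eta_t=\xi\}$. Suprema and expectations of nonnegative quantities take values in $[0,\infty]$. **Lemma.** Let $g:E\to\mathbb R$ be $\mu$-integrable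 with nonempty support $A=\{\eta:g(\eta)\ne0\}$ and $\int g\,d\mu=0$, and fix $\xi\in A$. Then, for every $t>0$, the expectations on the left-hand side below converge absolutely and $$\sup_{\eta\in E}\Big|\mathbf E_\eta\Big[\int_0^t g(\eta_s)\,ds\Big]\Big|\;\le\;2\,\sup_{\eta\in A}\mathbf E_\eta\Big[\int_0^{T_\xi}|g(\eta_s)|\,ds\Big].$$ **Corollary.** Let $S$ be a finite set, let $\pi=\{A^x:x\in S\}$ be a partition of $E$, and fix a state $\xi_x\in A^x$ for each $x\in S$. Let $\mu^x=\mu(\,\cdot\,|A^x)$. For a $\mu$-integrable $g:E\to\mathbb R$ let $\langle g|\pi\rangle_\mu=\sum_{x\in S}\big(\int g\,d\mu^x\big)\mathbf 1\{A^x\}$ be its conditional expectation given $\pi$ and let $g^x=\big(g-\int g\,d\mu^x\big)\mathbf 1\{A^x\}$. Then, for every $t>0$, the expectations on the left-hand side below converge absolutely and $$\sup_{\eta\in E}\Big|\mathbf E_\eta\Big[\int_0^t\big\{g-\langle g|\pi\rangle_\mu\big\}(\eta_s)\,ds\Big]\Big|\;\le\;2\sum_{x\in S}\ \sup_{\eta\in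 A^x}\mathbf E_\eta\Big[\int_0^{T_{\xi_x}}|g^x(\eta_s)|\,ds\Big].$$ -/

import Mathlib

open MeasureTheory ProbabilityTheory
open scoped ENNReal

noncomputable section

/-- Transition rates on `E`: finite nonnegative off-diagonal entries, strictly negative
diagonal entries, and rows summing to zero. -/
structure TransitionRates (E : Type*) where
  rate : E → E → ℝ
  rate_nonneg : ∀ η ξ, η ≠ ξ → 0 ≤ rate η ξ
  rate_self_neg : ∀ η, rate η η < 0
  hasSum_rate : ∀ η, HasSum (rate η) 0

/-- The hitting time `inf {s > 0 : e s ∈ A}` of a path `e`, equal to `∞` if the set is empty.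
Paths are indexed by `ℝ`, but only their values at nonnegative times are ever used. -/
def pathHittingTime {E : Type*} (e : ℝ → E) (A : Set E) : ℝ≥0∞ :=
  ⨅ (t : ℝ) (_ : 0 < t ∧ e t ∈ A), ENNReal.ofReal t

/-- The first return time `inf {t > 0 : e t ∈ A, e s ≠ e 0 for some 0 < s < t}`. -/
def pathReturnTime {E : Type*} (e : ℝ → E) (A : Set E) : ℝ≥0∞ :=
  ⨅ (t : ℝ) (_ : 0 < t ∧ e t ∈ A ∧ ∃ s, 0 < s ∧ s < t ∧ e s ≠ e 0), ENNReal.ofReal t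

namespace TransitionRates

variable {E : Type*} (Q : TransitionRates E)

/-- The holding rate `λ(η) = -R(η, η)`. -/
def holdingRate (η : E) : ℝ := -Q.rate η η

open Classical in
/-- The jump probabilities: `p(η, ξ) = R(η, ξ) / λ(η)` for `η ≠ ξ`, and `p(η, η) = 0`. -/
def jumpProb (η ξ : E) : ℝ := if η = ξ then 0 else Q.rate η ξ / Q.holdingRate η

theorem holdingRate_pos (η : E) : 0 < Q.holdingRate η := neg_pos.2 (Q.rate_self_neg η)

theorem jumpProb_nonneg (η ξ : E) : 0 ≤ Q.jumpProb η ξ := by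
  unfold jumpProb
  split_ifs with h
  · exact le_rfl
  · exact div_nonneg (Q.rate_nonneg η ξ h) (Q.holdingRate_pos η).le

theorem hasSum_jumpProb (η : E) : HasSum (Q.jumpProb η) 1 := by
  classical
  have h := ((Q.hasSum_rate η).update η 0).div_const (Q.holdingRate η)
  have h1 : (0 - Q.rate η η + 0) / Q.holdingRate η = 1 := by
    rw [zero_sub, add_zero]
    exact div_self (Q.holdingRate_pos η).ne'
  rw [h1] at h
  refine h.congr_fun ?_
  intro ξ
  unfold jumpProb
  by_cases hx : η = ξ
  · subst hx; simp
  · simp [hx, Function.update_of_ne (Ne.symm hx)]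

/-- The law of the position after one jump from `η`. -/
def jumpMeasure [MeasurableSpace E] (η : E) : Measure E :=
  Measure.sum fun ξ => ENNReal.ofReal (Q.jumpProb η ξ) • Measure.dirac ξ

instance [MeasurableSpace E] (η : E) : IsProbabilityMeasure (Q.jumpMeasure η) := by
  constructor
  rw [jumpMeasure, Measure.sum_apply _ MeasurableSet.univ]
  simp only [Measure.smul_apply, measure_univ, smul_eq_mul, mul_one]
  rw [← ENNReal.ofReal_tsum_of_nonneg (Q.jumpProb_nonneg η) (Q.hasSum_jumpProb η).summable,
    (Q.hasSum_jumpProb η).tsum_eq, ENNReal.ofReal_one]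

section Construction

variable [Countable E] [MeasurableSpace E] [DiscreteMeasurableSpace E]

/-- One step of the jump chain, given its past up to time `n`. -/
def jumpStep (n : ℕ) : Kernel ((i : Finset.Iic n) → (fun _ : ℕ => E) i) E where
  toFun y := Q.jumpMeasure (y ⟨n, Finset.mem_Iic.2 le_rfl⟩)
  measurable' := (Measurable.of_discrete (f := Q.jumpMeasure)).comp (measurable_pi_apply _)

instance (n : ℕ) : IsMarkovKernel (Q.jumpStep n) :=
  ⟨fun _ => inferInstanceAs (IsProbabilityMeasure (Q.jumpMeasure _))⟩

/-- The law of the jump chain `(Y_n)` started from `η`. -/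
def jumpChainLaw (η : E) : Measure (ℕ → E) :=
  Kernel.traj (X := fun _ => E) Q.jumpStep 0 (fun _ => η)

/-- The probability measure `P_η` on the sample space of pairs `(Y, e)`: under it, `Y` is the jump
chain started from `η`, and `e` is an independent sequence of i.i.d. mean one exponential
variables. -/
def pathMeasure (η : E) : Measure ((ℕ → E) × (ℕ → ℝ)) :=
  (Q.jumpChainLaw η).prod (Measure.infinitePi fun _ : ℕ => expMeasure 1)

end Construction

/-- `α(t) = min {n : ∑_{i ≤ n} e_i / λ(Y_i) > t}`. (It is `0` if there is no such `n`, which has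
probability zero when the jump chain is recurrent.) -/
def jumpIndex (t : ℝ) (ω : (ℕ → E) × (ℕ → ℝ)) : ℕ :=
  sInf {n : ℕ | t < ∑ i ∈ Finset.range (n + 1), ω.2 i / Q.holdingRate (ω.1 i)}

/-- The continuous time Markov chain `η_t = Y_{α(t)}`. -/
def process (t : ℝ) (ω : (ℕ → E) × (ℕ → ℝ)) : E := ω.1 (Q.jumpIndex t ω)

/-- The hitting time `T_ξ` of the state `ξ`. -/
def hittingTime (ξ : E) (ω : (ℕ → E) × (ℕ → ℝ)) : ℝ≥0∞ :=
  pathHittingTime (fun s => Q.process s ω) {ξ}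

/-- The first return time `T⁺_ξ` to the state `ξ`. -/
def returnTime (ξ : E) (ω : (ℕ → E) × (ℕ → ℝ)) : ℝ≥0∞ :=
  pathReturnTime (fun s => Q.process s ω) {ξ}

section Expectations

variable [Countable E] [MeasurableSpace E] [DiscreteMeasurableSpace E]

/-- The jump chain is irreducible. -/
def IsIrreducible : Prop := ∀ η ξ : E, ∃ n : ℕ, 0 < Q.jumpChainLaw η {y | y n = ξ}

/-- The jump chain is recurrent. -/
def IsRecurrent : Prop := ∀ η : E, ∀ᵐ y ∂Q.jumpChainLaw η, ∃ n : ℕ, 1 ≤ n ∧ y n = η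

/-- All mean return times of the continuous time chain are finite. Together with irreducibility and
recurrence of the jump chain (which excludes explosion) this is positive recurrence. -/
def HasFiniteMeanReturnTimes : Prop :=
  ∀ η : E, ∫⁻ ω, Q.returnTime η ω ∂Q.pathMeasure η < ∞

/-- `μ` is invariant for the continuous time chain:
`∑_η μ(η) P_η[η_t = ξ] = μ(ξ)` for all `t ≥ 0` and all `ξ`. -/
def IsInvariant (μ : Measure E) : Prop :=
  ∀ t : ℝ, 0 ≤ t → ∀ ξ : E,
    ∑' η : E, μ {η} * Q.pathMeasure η {ω | Q.process t ω = ξ} = μ {ξ}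

/-- The function `(ω, s) ↦ g(η_s(ω))` is integrable over `P_η ⊗ ds` on `0 ≤ s ≤ t`, that is,
`E_η[∫_0^t g(η_s) ds]` is absolutely convergent. -/
def TimeIntegrable (g : E → ℝ) (t : ℝ) (η : E) : Prop :=
  Integrable (fun p : ((ℕ → E) × (ℕ → ℝ)) × ℝ => g (Q.process p.2 p.1))
    ((Q.pathMeasure η).prod (volume.restrict (Set.Icc 0 t)))

/-- `E_η[∫_0^t g(η_s) ds]`. -/
def expTimeIntegral (g : E → ℝ) (t : ℝ) (η : E) : ℝ :=
  ∫ ω, (∫ s in (0 : ℝ)..t, g (Q.process s ω)) ∂Q.pathMeasure η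

/-- `E_η[∫_0^{T_ξ} |g(η_s)| ds]`, with values in `[0, ∞]`. -/
def expAbsIntegralUntilHit (g : E → ℝ) (ξ η : E) : ℝ≥0∞ :=
  ∫⁻ ω, (∫⁻ s in {s : ℝ | 0 ≤ s ∧ ENNReal.ofReal s < Q.hittingTime ξ ω},
    ENNReal.ofReal |g (Q.process s ω)|) ∂Q.pathMeasure η

end Expectations

end TransitionRates

/-- The conditional expectation `⟨g | π⟩_μ = ∑_x ⟨g⟩_{μ(· | A x)} 1{A x}` of `g` given the finite
partition `π = {A x}`. -/
def partitionCondExp {E S : Type*} [MeasurableSpace E] [Fintype S] (μ : Measure E)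
    (A : S → Set E) (g : E → ℝ) (η : E) : ℝ :=
  ∑ x, (A x).indicator (fun _ => ∫ ζ, g ζ ∂(cond μ (A x))) η

/-- `g^x = (g - ⟨g⟩_{μ(· | B)}) 1{B}` for the block `B = A x`. -/
def centeredOn {E : Type*} [MeasurableSpace E] (μ : Measure E) (B : Set E) (g : E → ℝ) : E → ℝ :=
  B.indicator fun η => g η - ∫ ζ, g ζ ∂(cond μ B)

end

noncomputable section

set_option linter.unusedSectionVars false

/-! ### Exponential clocks and the time spent in one holding interval. -/

section Exponential

/-! Let `C` be the supremum on the right and `p` the jump kernel. The potential of `g / λ` for the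
jump chain killed at `ξ` gives `f` with `f ξ = 0` and `f - p f = g / λ` off `ξ`. The maximum
principle carries the bound from the support of `g` to all of `E`, so `|f| ≤ C`
(`exists_poisson_solution`).

Let `g'` be `g` altered at `ξ` alone so that the Poisson equation holds there too. Dynkin's formula
bounds the expected time integral of `g'` by `2 * C`, uniformly in the time and the starting state
(`abs_expTimeIntegral_le`). It is proved on the jump chain: given the path `Y`, the mean time spent
in the `n`-th holding interval before `t` is `1 / λ(Y_n)` times the probability `a_{n+1}` that the
jump ending it occurs by `t`. As `a_{n+1}` depends only on `Y_0, ..., Y_n`, the integral becomes `∑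
E[(f(Y_n) - f(Y_{n+1})) a_{n+1}]`, and summation by parts with `a` decreasing from `1` gives `2 *
C`.

Averaging over `μ` turns the time integral into `t * ∫ g' dμ`. Boundedness in `t` forces `∫ g' dμ =
0 = ∫ g dμ`; since `μ {ξ} > 0`, this gives `g' = g`. The corollary sums this bound over the blocks.
-/

instance isProbabilityMeasure_expMeasure_one : IsProbabilityMeasure (expMeasure 1) :=
  isProbabilityMeasure_expMeasure one_pos

theorem lintegral_expMeasure_one (f : ℝ → ℝ≥0∞) (hf : Measurable f) :
    ∫⁻ x, f x ∂expMeasure 1 = ∫⁻ x in Set.Ioi 0, ENNReal.ofReal (Real.exp (-x)) * f x := by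
  have h : expMeasure 1 = volume.withDensity (exponentialPDF 1) := rfl
  have hm : Measurable (exponentialPDF 1) := (measurable_exponentialPDFReal 1).ennreal_ofReal
  rw [h, lintegral_withDensity_eq_lintegral_mul _ hm hf, ← setLIntegral_congr Ioi_ae_eq_Ici.symm,
    ← lintegral_indicator measurableSet_Ici]
  refine lintegral_congr fun x => ?_
  by_cases hx : 0 ≤ x
  · simp [hx, exponentialPDF_of_nonneg]
  · simp [hx, exponentialPDF_of_neg (not_le.1 hx)]

theorem expMeasure_one_Ioi {u : ℝ} (hu : 0 ≤ u) :
    expMeasure 1 (Set.Ioi u) = ENNReal.ofReal (Real.exp (-u)) := by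
  rw [← lintegral_indicator_one measurableSet_Ioi,
    lintegral_expMeasure_one _ (measurable_one.indicator measurableSet_Ioi)]
  have : ∀ x, ENNReal.ofReal (Real.exp (-x)) * (Set.Ioi u).indicator 1 x =
      (Set.Ioi u).indicator (fun x => ENNReal.ofReal (Real.exp (-x))) x := by
    intro x
    by_cases hx : u < x <;> simp [hx]
  simp_rw [this]
  rw [setLIntegral_indicator measurableSet_Ioi,
    Set.inter_eq_left.2 (Set.Ioi_subset_Ioi hu), ← ofReal_integral_eq_lintegral_ofReal,
    integral_exp_neg_Ioi]
  · have h := exp_neg_integrableOn_Ioi u one_pos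
    simp only [neg_mul, one_mul] at h
    exact h
  · exact Filter.Eventually.of_forall fun x => (Real.exp_pos _).le

theorem ae_expMeasure_one_nonneg : ∀ᵐ x ∂expMeasure 1, 0 ≤ x := by
  rw [ae_iff]
  have h := prob_compl_eq_one_sub (μ := expMeasure 1) (measurableSet_Ioi (a := (0 : ℝ)))
  rw [expMeasure_one_Ioi le_rfl] at h
  refine measure_mono_null ?_ (h.trans (by simp))
  intro x hx
  simpa using (not_le.1 hx).le

theorem expMeasure_one_Iic {u : ℝ} (hu : 0 ≤ u) :
    expMeasure 1 (Set.Iic u) = ENNReal.ofReal (1 - Real.exp (-u)) := by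
  rw [← Set.compl_Ioi, prob_compl_eq_one_sub measurableSet_Ioi, expMeasure_one_Ioi hu,
    ENNReal.ofReal_sub _ (Real.exp_pos _).le, ENNReal.ofReal_one]

theorem lintegral_ofReal_expMeasure_one : ∫⁻ x, ENNReal.ofReal x ∂expMeasure 1 = 1 := by
  rw [lintegral_expMeasure_one _ ENNReal.measurable_ofReal]
  have h := Real.Gamma_eq_integral (s := 2) two_pos
  have hi := Real.GammaIntegral_convergent (s := 2) two_pos
  rw [Real.Gamma_two] at h
  rw [← ENNReal.ofReal_one, h, ofReal_integral_eq_lintegral_ofReal hi]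
  · refine setLIntegral_congr_fun measurableSet_Ioi fun x hx => ?_
    rw [← ENNReal.ofReal_mul (Real.exp_pos _).le]
    norm_num
  · refine (ae_restrict_iff' measurableSet_Ioi).2 (Filter.Eventually.of_forall fun x hx => ?_)
    exact mul_nonneg (Real.exp_pos _).le (Real.rpow_nonneg (le_of_lt hx) _)

theorem lintegral_exp_neg_div_expMeasure_one {l : ℝ} (hl : 0 < l) :
    ∫⁻ x, ENNReal.ofReal (Real.exp (-(x / l))) ∂expMeasure 1 = ENNReal.ofReal (l / (1 + l)) := by
  rw [lintegral_expMeasure_one _ (by fun_prop)]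
  have hb : 0 < 1 + 1 / l := by positivity
  have : ∀ x : ℝ, ENNReal.ofReal (Real.exp (-x)) * ENNReal.ofReal (Real.exp (-(x / l))) =
      ENNReal.ofReal (Real.exp (-(1 + 1 / l) * x)) := by
    intro x
    rw [← ENNReal.ofReal_mul (Real.exp_pos _).le, ← Real.exp_add]
    congr 2; ring
  simp_rw [this]
  rw [← ofReal_integral_eq_lintegral_ofReal (exp_neg_integrableOn_Ioi 0 hb), integral_exp_mul_Ioi]
  · rw [mul_zero, Real.exp_zero, neg_div_neg_eq, one_add_div hl.ne', one_div_div, add_comm]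
  · linarith
  · exact Filter.Eventually.of_forall fun x => (Real.exp_pos _).le

theorem intervalIntegral_exp_neg_mul {l : ℝ} (hl : 0 < l) (r : ℝ) :
    ∫ u in (0 : ℝ)..r, Real.exp (-l * u) = 1 / l * (1 - Real.exp (-(l * r))) := by
  rw [intervalIntegral.integral_comp_mul_left (fun x => Real.exp x) (neg_ne_zero.2 hl.ne'),
    integral_exp]
  simp only [smul_eq_mul, mul_zero, Real.exp_zero, neg_mul]
  field_simp
  ring

/-- Layer cake: the left side is the integral of `exp (-l u)` over `0 < u < r`. Writing the value as
a probability is what later produces the event that the next jump occurs by `t`. -/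
theorem lintegral_min_expMeasure_one {l r : ℝ} (hl : 0 < l) (hr : 0 ≤ r) :
    ∫⁻ x, ENNReal.ofReal (min (x / l) r) ∂expMeasure 1 =
      ENNReal.ofReal (1 / l) * expMeasure 1 (Set.Iic (l * r)) := by
  rw [lintegral_eq_lintegral_meas_lt]
  · have h1 : ∀ u ∈ Set.Ioi (0 : ℝ), expMeasure 1 {x | u < min (x / l) r} =
        (Set.Iio r).indicator (fun u => ENNReal.ofReal (Real.exp (-l * u))) u := by
      intro u hu
      by_cases hur : u < r
      · have : {x | u < min (x / l) r} = Set.Ioi (l * u) := by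
          ext x; simp [hur, lt_div_iff₀ hl, mul_comm]
        rw [this, expMeasure_one_Ioi (mul_nonneg hl.le (le_of_lt hu))]
        simp [hur]
      · simp [hur]
    rw [setLIntegral_congr_fun measurableSet_Ioi h1, setLIntegral_indicator measurableSet_Iio,
      Set.inter_comm, Set.Ioi_inter_Iio, setLIntegral_congr Ioo_ae_eq_Ioc,
      ← ofReal_integral_eq_lintegral_ofReal, ← intervalIntegral.integral_of_le hr,
      intervalIntegral_exp_neg_mul hl, expMeasure_one_Iic (by positivity),
      ← ENNReal.ofReal_mul (by positivity)]
    · exact (Continuous.integrableOn_Icc (by fun_prop)).mono_set Set.Ioc_subset_Icc_self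
    · exact Filter.Eventually.of_forall fun x => (Real.exp_pos _).le
  · filter_upwards [ae_expMeasure_one_nonneg] with x hx
    exact le_min (div_nonneg hx hl.le) hr
  · fun_prop

/-- The law of the sequence of the exponential clocks. -/
def expSeq : Measure (ℕ → ℝ) := Measure.infinitePi fun _ : ℕ => expMeasure 1

instance : IsProbabilityMeasure expSeq := by unfold expSeq; infer_instance

/-- The `n`-th jump time of the clocks `e` with holding rates `l`. -/
def clockSum (l e : ℕ → ℝ) (n : ℕ) : ℝ := ∑ i ∈ Finset.range n, e i / l i

@[simp] theorem clockSum_zero (l e : ℕ → ℝ) : clockSum l e 0 = 0 := by simp [clockSum]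

theorem clockSum_succ (l e : ℕ → ℝ) (n : ℕ) :
    clockSum l e (n + 1) = clockSum l e n + e n / l n := Finset.sum_range_succ _ _

@[fun_prop]
theorem measurable_clockSum (l : ℕ → ℝ) (n : ℕ) : Measurable fun e => clockSum l e n := by
  unfold clockSum
  fun_prop

theorem expSeq_map_eval (n : ℕ) : expSeq.map (fun e => e n) = expMeasure 1 :=
  Measure.infinitePi_map_eval (fun _ : ℕ => expMeasure 1) n

theorem ae_expSeq_nonneg : ∀ᵐ e ∂expSeq, ∀ n, 0 ≤ e n := by
  rw [ae_all_iff]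
  intro n
  have h := ae_expMeasure_one_nonneg
  rw [← expSeq_map_eval n] at h
  exact ae_of_ae_map (measurable_pi_apply n).aemeasurable h

/-- The `n`-th jump time uses only the clocks with index below `n`, so it is independent of the
clock `e n`, which may be replaced by a fresh exponential variable. -/
theorem lintegral_clockSum_pair (l : ℕ → ℝ) (n : ℕ) (k : ℝ → ℝ → ℝ≥0∞)
    (hk : Measurable fun p : ℝ × ℝ => k p.1 p.2) :
    ∫⁻ e, k (clockSum l e n) (e n) ∂expSeq =
      ∫⁻ e, ∫⁻ x, k (clockSum l e n) x ∂expMeasure 1 ∂expSeq := by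
  have hind' : iIndepFun (fun i (e : ℕ → ℝ) => e i) expSeq :=
    iIndepFun_infinitePi (X := fun i x => x) (by fun_prop)
  have hψ : Measurable fun z : (({n} : Finset ℕ) → ℝ) => z ⟨n, Finset.mem_singleton_self n⟩ :=
    measurable_pi_apply _
  have h := (hind'.indepFun_finset (Finset.range n) {n} (by simp) measurable_pi_apply).comp
    (φ := fun z => ∑ i : Finset.range n, z i / l i) (by fun_prop) hψ
  have h1 : IndepFun (fun e => clockSum l e n) (fun e : ℕ → ℝ => e n) expSeq := by
    convert h using 1
    · funext e
      simp only [Function.comp, clockSum]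
      exact (Finset.sum_coe_sort (Finset.range n) fun i => e i / l i).symm
    · rfl
  have h2 := h1.map_prod_eq_prod_map_map (by fun_prop) (measurable_pi_apply n).aemeasurable
  rw [expSeq_map_eval] at h2
  calc ∫⁻ e, k (clockSum l e n) (e n) ∂expSeq
      = ∫⁻ p, k p.1 p.2 ∂(expSeq.map fun e => (clockSum l e n, e n)) := by
        rw [lintegral_map hk (by fun_prop)]
    _ = ∫⁻ s, ∫⁻ x, k s x ∂expMeasure 1 ∂(expSeq.map fun e => clockSum l e n) := by
        rw [h2, lintegral_prod _ hk.aemeasurable]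
    _ = _ := by
        rw [lintegral_map hk.lintegral_prod_right' (by fun_prop)]

theorem volume_Ico_inter_Icc {a b t : ℝ} (ha : 0 ≤ a) :
    volume (Set.Ico a b ∩ Set.Icc 0 t) = ENNReal.ofReal (min (b - a) (t - a)) := by
  have h : (Set.Ico a b ∩ Set.Icc 0 t : Set ℝ) =ᵐ[volume] (Set.Icc a b ∩ Set.Icc 0 t : Set ℝ) :=
    Ico_ae_eq_Icc.inter Filter.EventuallyEq.rfl
  rw [measure_congr h, Set.Icc_inter_Icc, Real.volume_Icc, sup_eq_left.2 ha, ← min_sub_sub_right]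

theorem clockSum_mono {l e : ℕ → ℝ} (hl : ∀ n, 0 < l n) (he : ∀ n, 0 ≤ e n) :
    Monotone (clockSum l e) :=
  monotone_nat_of_le_succ fun n => by
    rw [clockSum_succ]
    exact le_add_of_nonneg_right (div_nonneg (he n) (hl n).le)

theorem clockSum_nonneg {l e : ℕ → ℝ} (hl : ∀ n, 0 < l n) (he : ∀ n, 0 ≤ e n) (n : ℕ) :
    0 ≤ clockSum l e n := by
  simpa using clockSum_mono hl he (Nat.zero_le n)

/-- The expected time spent in the `n`-th holding interval before `t`. -/
theorem lintegral_min_holding {l : ℕ → ℝ} (hl : ∀ n, 0 < l n) (t : ℝ) (n : ℕ) :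
    ∫⁻ e, ENNReal.ofReal (min (e n / l n) (t - clockSum l e n)) ∂expSeq =
      ENNReal.ofReal (1 / l n) * expSeq {e | clockSum l e (n + 1) ≤ t} := by
  have hms : MeasurableSet {p : ℝ × ℝ | p.1 + p.2 / l n ≤ t} :=
    measurableSet_le (by fun_prop) (by fun_prop)
  have key : ∀ s, ∫⁻ x, ENNReal.ofReal (min (x / l n) (t - s)) ∂expMeasure 1 =
      ENNReal.ofReal (1 / l n) * expMeasure 1 {x | s + x / l n ≤ t} := by
    intro s
    rcases le_or_gt s t with hst | hst
    · rw [lintegral_min_expMeasure_one (hl n) (sub_nonneg.2 hst)]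
      congr 2
      ext x
      simp only [Set.mem_Iic, Set.mem_ofPred_eq]
      rw [← div_le_iff₀' (hl n), le_sub_iff_add_le']
    · have h1 : ∀ x, ENNReal.ofReal (min (x / l n) (t - s)) = 0 := fun x =>
        ENNReal.ofReal_eq_zero.2 ((min_le_right _ _).trans (by linarith))
      have h2 : expMeasure 1 {x | s + x / l n ≤ t} = 0 := by
        refine measure_mono_null (t := {x | ¬ 0 ≤ x}) (fun x hx => ?_)
          (ae_iff.1 ae_expMeasure_one_nonneg)
        simp only [Set.mem_ofPred_eq] at hx ⊢
        intro h0
        have := div_nonneg h0 (hl n).le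
        linarith
      simp [h1, h2]
  calc _ = ∫⁻ e, ENNReal.ofReal (1 / l n) * expMeasure 1 {x | clockSum l e n + x / l n ≤ t}
          ∂expSeq := by
        rw [lintegral_clockSum_pair l n
          (fun s x => ENNReal.ofReal (min (x / l n) (t - s))) (by fun_prop)]
        simp_rw [key]
    _ = ENNReal.ofReal (1 / l n) *
          ∫⁻ e, ∫⁻ x, {p : ℝ × ℝ | p.1 + p.2 / l n ≤ t}.indicator 1 (clockSum l e n, x)
            ∂expMeasure 1 ∂expSeq := by
        rw [lintegral_const_mul' _ _ ENNReal.ofReal_ne_top]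
        congr 1
        refine lintegral_congr fun e => ?_
        rw [← lintegral_indicator_one (measurableSet_le (by fun_prop) (by fun_prop))]
        rfl
    _ = _ := by
        rw [← lintegral_clockSum_pair l n
          (fun s x => {p : ℝ × ℝ | p.1 + p.2 / l n ≤ t}.indicator 1 (s, x))
          (measurable_one.indicator hms),
          ← lintegral_indicator_one (measurableSet_le (by fun_prop) (by fun_prop))]
        congr 1
        refine lintegral_congr fun e => ?_
        simp only [Set.indicator, Set.mem_ofPred_eq, clockSum_succ, Pi.one_apply]

/-- The Laplace transform factorises by independence. Its factors act as survival probabilities in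
the proof of non-explosion. -/
theorem lintegral_exp_neg_clockSum {l : ℕ → ℝ} (hl : ∀ n, 0 < l n) (n : ℕ) :
    ∫⁻ e, ENNReal.ofReal (Real.exp (-clockSum l e n)) ∂expSeq =
      ∏ i ∈ Finset.range n, ENNReal.ofReal (l i / (1 + l i)) := by
  induction n with
  | zero => simp
  | succ n ih =>
    rw [Finset.prod_range_succ, ← ih, ← lintegral_exp_neg_div_expMeasure_one (hl n),
      ← lintegral_mul_const' _ _ (by rw [lintegral_exp_neg_div_expMeasure_one (hl n)]; simp)]
    have h : ∀ s x : ℝ, ENNReal.ofReal (Real.exp (-(s + x / l n))) =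
        ENNReal.ofReal (Real.exp (-s)) * ENNReal.ofReal (Real.exp (-(x / l n))) := fun s x => by
      rw [← ENNReal.ofReal_mul (Real.exp_pos _).le, ← Real.exp_add, neg_add]
    simp_rw [clockSum_succ]
    rw [lintegral_clockSum_pair l n
      (fun s x => ENNReal.ofReal (Real.exp (-(s + x / l n)))) (by fun_prop)]
    refine lintegral_congr fun e => ?_
    simp_rw [h]
    rw [lintegral_const_mul' _ _ ENNReal.ofReal_ne_top]

theorem lintegral_holding {l : ℕ → ℝ} (hl : ∀ n, 0 < l n) (n : ℕ) :
    ∫⁻ e, ENNReal.ofReal (e n / l n) ∂expSeq = ENNReal.ofReal (1 / l n) := by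
  have h : ∀ e : ℕ → ℝ, ENNReal.ofReal (e n / l n) =
      ENNReal.ofReal (e n) * ENNReal.ofReal (1 / l n) := fun e => by
    rw [← ENNReal.ofReal_mul' (by have := hl n; positivity), mul_one_div]
  simp_rw [h]
  rw [lintegral_mul_const' _ _ ENNReal.ofReal_ne_top,
    ← lintegral_map (f := ENNReal.ofReal) (g := fun e : ℕ → ℝ => e n) (by fun_prop) (by fun_prop),
    expSeq_map_eval, lintegral_ofReal_expMeasure_one, one_mul]

end Exponential

/-! ### The jump chain: Markov property and extinction under killing. -/

theorem exists_factor_frestrictLe {E β : Type*} {n : ℕ} {G : (ℕ → E) → β}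
    (hG : ∀ y y' : ℕ → E, (∀ i ≤ n, y i = y' i) → G y = G y') :
    ∃ G' : ((i : Finset.Iic n) → E) → β,
      ∀ y, G y = G' (Preorder.frestrictLe (π := fun _ : ℕ => E) n y) := by
  -- Coordinates beyond `n` are irrelevant to `G`; they are filled with the value at time `0`, so no
  -- default element of `E` is needed.
  refine ⟨fun z => G fun i => if h : i ≤ n then z ⟨i, Finset.mem_Iic.2 h⟩ else
    z ⟨0, Finset.mem_Iic.2 (Nat.zero_le n)⟩, fun y => hG _ _ fun i hi => ?_⟩
  simp [hi]

namespace TransitionRates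

variable {E : Type*} [Countable E] [MeasurableSpace E] [DiscreteMeasurableSpace E]
  (Q : TransitionRates E)

instance (η : E) : IsProbabilityMeasure (Q.jumpChainLaw η) := by
  unfold jumpChainLaw; infer_instance

theorem ae_jumpChainLaw_zero (η : E) : ∀ᵐ y ∂Q.jumpChainLaw η, y 0 = η := by
  have h := Kernel.traj_map_frestrictLe_apply (X := fun _ => E) (κ := Q.jumpStep) 0 0 (fun _ => η)
  rw [Kernel.partialTraj_self, Kernel.id_apply] at h
  have h2 : ∀ᵐ z ∂(Q.jumpChainLaw η).map (Preorder.frestrictLe (π := fun _ : ℕ => E) 0),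
      z ⟨0, Finset.mem_Iic.2 le_rfl⟩ = η := by
    rw [jumpChainLaw, h, ae_dirac_eq]
    rfl
  exact ae_of_ae_map (by fun_prop) h2

theorem jumpChainLaw_map_succ (η : E) (n : ℕ) :
    (Q.jumpChainLaw η).map (fun y => (Preorder.frestrictLe (π := fun _ : ℕ => E) n y, y (n + 1))) =
      ((Q.jumpChainLaw η).map (Preorder.frestrictLe (π := fun _ : ℕ => E) n)) ⊗ₘ Q.jumpStep n := by
  rw [jumpChainLaw, Kernel.traj_map_frestrictLe_apply,
    Kernel.partialTraj_compProd_eq_map_traj (Nat.zero_le n)]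

/-- One-step Markov property of the jump chain. -/
theorem lintegral_jumpChainLaw_succ (η : E) (n : ℕ) {G : (ℕ → E) → ℝ≥0∞}
    (hG : ∀ y y' : ℕ → E, (∀ i ≤ n, y i = y' i) → G y = G y') (h : E → ℝ≥0∞) :
    ∫⁻ y, G y * h (y (n + 1)) ∂Q.jumpChainLaw η =
      ∫⁻ y, G y * ∫⁻ x, h x ∂Q.jumpMeasure (y n) ∂Q.jumpChainLaw η := by
  obtain ⟨G', hG'⟩ := exists_factor_frestrictLe hG
  have mG : Measurable G' := Measurable.of_discrete
  have mh : Measurable h := Measurable.of_discrete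
  have mk : Measurable fun p : ((i : Finset.Iic n) → E) × E => G' p.1 * h p.2 := by fun_prop
  have hr : Measurable (Preorder.frestrictLe (π := fun _ : ℕ => E) n) := by fun_prop
  calc ∫⁻ y, G y * h (y (n + 1)) ∂Q.jumpChainLaw η
      = ∫⁻ p, G' p.1 * h p.2 ∂((Q.jumpChainLaw η).map
          fun y => (Preorder.frestrictLe (π := fun _ : ℕ => E) n y, y (n + 1))) := by
        rw [lintegral_map mk (by fun_prop)]
        simp_rw [hG']
    _ = _ := by
        rw [jumpChainLaw_map_succ, Measure.lintegral_compProd mk,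
          lintegral_map mk.lintegral_kernel_prod_right' hr]
        refine lintegral_congr fun y => ?_
        simp only
        rw [lintegral_const_mul _ mh, hG']
        rfl

theorem integral_jumpChainLaw_succ (η : E) (n : ℕ) {G : (ℕ → E) → ℝ}
    (hG : ∀ y y' : ℕ → E, (∀ i ≤ n, y i = y' i) → G y = G y') {B : ℝ} (hB : ∀ y, |G y| ≤ B)
    {h : E → ℝ} {C : ℝ} (hC : ∀ x, |h x| ≤ C) :
    ∫ y, G y * h (y (n + 1)) ∂Q.jumpChainLaw η =
      ∫ y, G y * ∫ x, h x ∂Q.jumpMeasure (y n) ∂Q.jumpChainLaw η := by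
  obtain ⟨G', hG'⟩ := exists_factor_frestrictLe hG
  have mG : Measurable G' := Measurable.of_discrete
  have mh : Measurable h := Measurable.of_discrete
  have mk : Measurable fun p : ((i : Finset.Iic n) → E) × E => G' p.1 * h p.2 := by fun_prop
  have hr : Measurable (Preorder.frestrictLe (π := fun _ : ℕ => E) n) := by fun_prop
  have hpair : Measurable fun y : ℕ → E =>
    (Preorder.frestrictLe (π := fun _ : ℕ => E) n y, y (n + 1)) := by fun_prop
  have hint : Integrable (fun p : ((i : Finset.Iic n) → E) × E => G' p.1 * h p.2)
      ((Q.jumpChainLaw η).map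
          fun y => (Preorder.frestrictLe (π := fun _ : ℕ => E) n y, y (n + 1))) := by
    rw [integrable_map_measure mk.aestronglyMeasurable hpair.aemeasurable]
    refine Integrable.of_bound (mk.comp hpair).aestronglyMeasurable (B * C)
      (Filter.Eventually.of_forall fun y => ?_)
    simp only [Function.comp, ← hG', Real.norm_eq_abs, abs_mul]
    exact mul_le_mul (hB y) (hC _) (abs_nonneg _) ((abs_nonneg _).trans (hB y))
  have hint2 := hint
  rw [jumpChainLaw_map_succ] at hint2
  calc ∫ y, G y * h (y (n + 1)) ∂Q.jumpChainLaw η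
      = ∫ p, G' p.1 * h p.2 ∂((Q.jumpChainLaw η).map
          fun y => (Preorder.frestrictLe (π := fun _ : ℕ => E) n y, y (n + 1))) := by
        rw [integral_map hpair.aemeasurable mk.aestronglyMeasurable]
        simp_rw [hG']
    _ = _ := by
        rw [jumpChainLaw_map_succ, Measure.integral_compProd hint2,
          integral_map hr.aemeasurable Measurable.of_discrete.aestronglyMeasurable]
        refine integral_congr_ae (Filter.Eventually.of_forall fun y => ?_)
        simp only
        rw [integral_const_mul, hG']
        rfl

/-- The operator `h ↦ c · p h` of the jump chain weighted by `c`. -/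
def weightedStep (c h : E → ℝ≥0∞) (η : E) : ℝ≥0∞ := c η * ∫⁻ x, h x ∂Q.jumpMeasure η

/-- A discrete Feynman–Kac formula: the Markov property at the last step absorbs the last weight
into the terminal function. -/
theorem lintegral_prod_weight (η : E) (c : E → ℝ≥0∞) (n : ℕ) (h : E → ℝ≥0∞) :
    ∫⁻ y, (∏ i ∈ Finset.range n, c (y i)) * h (y n) ∂Q.jumpChainLaw η =
      (Q.weightedStep c)^[n] h η := by
  induction n generalizing h with
  | zero =>
    rw [lintegral_congr_ae (g := fun _ => h η)]
    · simp
    · filter_upwards [Q.ae_jumpChainLaw_zero η] with y hy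
      simp [hy]
  | succ n ih =>
    rw [Function.iterate_succ_apply, ← ih, Q.lintegral_jumpChainLaw_succ η n]
    · refine lintegral_congr fun y => ?_
      rw [Finset.prod_range_succ, mul_assoc]
      rfl
    · intro y y' hy
      exact Finset.prod_congr rfl fun i hi => by
        rw [hy i (Nat.lt_succ_iff.1 (Finset.mem_range.1 hi))]

/-- Here the weights start at time `1`, so that the starting state is exempt; this is suited to
return probabilities. -/
theorem lintegral_prod_weight_shift (η : E) (c : E → ℝ≥0∞) (n : ℕ) (h : E → ℝ≥0∞) :
    ∫⁻ y, (∏ i ∈ Finset.range n, c (y (i + 1))) * h (y (n + 1)) ∂Q.jumpChainLaw η =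
      ∫⁻ x, (Q.weightedStep c)^[n] h x ∂Q.jumpMeasure η := by
  induction n generalizing h with
  | zero =>
    rw [Q.lintegral_jumpChainLaw_succ η 0 (by simp),
      lintegral_congr_ae (g := fun _ => ∫⁻ x, h x ∂Q.jumpMeasure η)]
    · simp
    · filter_upwards [Q.ae_jumpChainLaw_zero η] with y hy
      simp [hy]
  | succ n ih =>
    simp_rw [Function.iterate_succ_apply]
    rw [← ih, Q.lintegral_jumpChainLaw_succ η (n + 1)]
    · refine lintegral_congr fun y => ?_
      rw [Finset.prod_range_succ, mul_assoc]
      rfl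
    · intro y y' hy
      exact Finset.prod_congr rfl fun i hi => by
        rw [hy (i + 1) (Finset.mem_range.1 hi)]

/-- The integral is the probability of avoiding `η` at times `1, ..., n + 1`. These events decrease
to that of never returning, which is null. -/
theorem tendsto_avoid_of_recurrent (hrec : Q.IsRecurrent) (η : E) (d : E → ℝ≥0∞)
    (hd : d = Set.indicator {η}ᶜ 1) :
    Filter.Tendsto (fun n => ∫⁻ x, (Q.weightedStep d)^[n] d x ∂Q.jumpMeasure η) Filter.atTop
      (nhds 0) := by
  have hmi : ∀ i : ℕ, MeasurableSet {y : ℕ → E | y (i + 1) ≠ η} := fun i =>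
    measurableSet_preimage (f := fun y : ℕ → E => y (i + 1)) (t := {η}ᶜ)
      (measurable_pi_apply (i + 1)) MeasurableSet.of_discrete
  have h1 : ∀ n, ∫⁻ x, (Q.weightedStep d)^[n] d x ∂Q.jumpMeasure η =
      Q.jumpChainLaw η (⋂ i ∈ Finset.range (n + 1), {y | y (i + 1) ≠ η}) := by
    intro n
    have hm : MeasurableSet (⋂ i ∈ Finset.range (n + 1), {y : ℕ → E | y (i + 1) ≠ η}) :=
      Finset.measurableSet_biInter _ fun i _ =>
        hmi i
    rw [← lintegral_prod_weight_shift, ← lintegral_indicator_one hm]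
    refine lintegral_congr fun y => ?_
    rw [← Finset.prod_range_succ (fun i => d (y (i + 1)))]
    by_cases hy : ∀ i ∈ Finset.range (n + 1), y (i + 1) ≠ η
    · rw [Finset.prod_eq_one, Set.indicator_of_mem (by simpa using hy)]
      · rfl
      · intro i hi
        rw [hd, Set.indicator_of_mem (by simpa using hy i hi)]
        rfl
    · rw [Set.indicator_of_notMem (by simpa using hy)]
      push Not at hy
      obtain ⟨i, hi, hi'⟩ := hy
      exact Finset.prod_eq_zero hi (by simp [hd, hi'])
  simp_rw [h1]
  have h0 : Q.jumpChainLaw η (⋂ n, ⋂ i ∈ Finset.range (n + 1), {y | y (i + 1) ≠ η}) = 0 := by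
    refine measure_mono_null (fun y hy => ?_) (ae_iff.1 (hrec η))
    simp only [Set.mem_iInter] at hy
    rintro ⟨n, hn, hyn⟩
    refine hy n (n - 1) (Finset.mem_range.2 (by omega)) ?_
    rwa [Nat.sub_add_cancel hn]
  rw [← h0]
  refine tendsto_measure_iInter_atTop (fun n => ?_) (fun m n hmn => ?_) ⟨0, measure_ne_top _ _⟩
  · exact (Finset.measurableSet_biInter _ fun i _ =>
hmi i).nullMeasurableSet
  · exact Set.biInter_subset_biInter_left fun i hi =>
      Finset.mem_range.2 ((Finset.mem_range.1 hi).trans_le (by omega))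

theorem weightedStep_mono (c : E → ℝ≥0∞) : Monotone (Q.weightedStep c) := fun _ _ h η =>
  mul_le_mul_right (lintegral_mono h) (c η)

/-- A recurrent chain killed with positive probability at every visit dies. -/
theorem tendsto_lintegral_prod_weight (hrec : Q.IsRecurrent) {c : E → ℝ≥0∞} (hc : ∀ x, c x < 1)
    (η : E) :
    Filter.Tendsto (fun n => ∫⁻ y, ∏ i ∈ Finset.range n, c (y i) ∂Q.jumpChainLaw η) Filter.atTop
      (nhds 0) := by
  set φ : ℕ → E → ℝ≥0∞ := fun n => (Q.weightedStep c)^[n] 1 with hφ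
  have hφs : ∀ n, φ (n + 1) = Q.weightedStep c (φ n) := fun n =>
    Function.iterate_succ_apply' _ _ _
  have hE : ∀ n, ∫⁻ y, ∏ i ∈ Finset.range n, c (y i) ∂Q.jumpChainLaw η = φ n η := fun n => by
    simp only [hφ, ← Q.lintegral_prod_weight η c n 1]
    simp
  simp_rw [hE]
  have hanti : Antitone φ := by
    refine antitone_nat_of_succ_le fun n => ?_
    induction n with
    | zero =>
      intro x
      rw [hφs]
      simp [φ, weightedStep, (hc x).le]
    | succ n ih =>
      rw [hφs]
      nth_rewrite 2 [hφs]
      exact Q.weightedStep_mono c ih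
  have hle1 : ∀ n x, φ n x ≤ 1 := fun n x => hanti (Nat.zero_le n) x
  set d : E → ℝ≥0∞ := Set.indicator {η}ᶜ 1 with hd
  -- Either `η` is visited by time `n`, leaving at least `N` weights to collect from there, or it is
  -- avoided throughout times `0, ..., n`.
  have hbd : ∀ N n x, φ (N + n) x ≤ φ N η + (Q.weightedStep d)^[n] d x := by
    intro N n
    induction n with
    | zero =>
      intro x
      by_cases hx : x = η
      · simp [hx]
      · simpa [hd, hx] using le_add_left (hle1 N x)
    | succ n ih =>
      intro x
      by_cases hx : x = η
      · exact (hanti (Nat.le_add_right N (n + 1)) x).trans (by simp [hx])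
      · rw [← add_assoc, hφs, Function.iterate_succ_apply']
        calc c x * ∫⁻ z, φ (N + n) z ∂Q.jumpMeasure x
            ≤ 1 * ∫⁻ z, (φ N η + (Q.weightedStep d)^[n] d z) ∂Q.jumpMeasure x :=
              mul_le_mul' (hc x).le (lintegral_mono ih)
          _ = _ := by
              rw [lintegral_add_left measurable_const]
              simp [weightedStep, hd, hx]
  have hstep : ∀ N n, φ (N + n + 1) η ≤
      c η * (φ N η + ∫⁻ x, (Q.weightedStep d)^[n] d x ∂Q.jumpMeasure η) := by
    intro N n
    rw [hφs]
    refine mul_le_mul_right ((lintegral_mono (hbd N n)).trans ?_) _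
    rw [lintegral_add_left measurable_const]
    simp
  have hlim : Filter.Tendsto (fun n => φ n η) Filter.atTop (nhds (⨅ n, φ n η)) :=
    tendsto_atTop_iInf fun m n h => hanti h η
  have hL : ∀ N, (⨅ n, φ n η) ≤ c η * φ N η := by
    intro N
    have hr := ENNReal.Tendsto.const_mul (a := c η)
      ((Q.tendsto_avoid_of_recurrent hrec η d hd).const_add (φ N η))
      (Or.inr ((hc η).trans ENNReal.one_lt_top).ne)
    rw [add_zero] at hr
    exact ge_of_tendsto' hr fun n => (iInf_le _ (N + n + 1)).trans (hstep N n)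
  -- The finite limit is at most `c η < 1` times itself, hence zero.
  have hL2 : (⨅ n, φ n η) ≤ c η * ⨅ n, φ n η := by
    exact ge_of_tendsto' (ENNReal.Tendsto.const_mul hlim
      (Or.inr ((hc η).trans ENNReal.one_lt_top).ne)) hL
  have hz : (⨅ n, φ n η) = 0 := by
    by_contra h0
    have htop : (⨅ n, φ n η) ≠ ∞ := ((iInf_le _ 0).trans_lt
      ((hle1 0 η).trans_lt ENNReal.one_lt_top)).ne
    have := ENNReal.mul_lt_mul_left h0 htop (hc η)
    rw [one_mul] at this
    exact absurd hL2 (not_le.2 this)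
  rwa [hz] at hlim

end TransitionRates

/-! ### The continuous time process: jump times, non-explosion, occupation times. -/

namespace TransitionRates

variable {E : Type*} [Countable E] [MeasurableSpace E] [DiscreteMeasurableSpace E]
  (Q : TransitionRates E)

/-- The holding rates along a path of the jump chain. -/
def pathRates (y : ℕ → E) (i : ℕ) : ℝ := Q.holdingRate (y i)

/-- The `n`-th jump time. -/
def jumpTime (ω : (ℕ → E) × (ℕ → ℝ)) (n : ℕ) : ℝ := clockSum (Q.pathRates ω.1) ω.2 n

theorem pathRates_pos (y : ℕ → E) (n : ℕ) : 0 < Q.pathRates y n := Q.holdingRate_pos _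

theorem jumpTime_succ (ω : (ℕ → E) × (ℕ → ℝ)) (n : ℕ) :
    Q.jumpTime ω (n + 1) = Q.jumpTime ω n + ω.2 n / Q.holdingRate (ω.1 n) := clockSum_succ _ _ _

theorem jumpTime_nonneg {ω : (ℕ → E) × (ℕ → ℝ)} (hω : ∀ n, 0 ≤ ω.2 n) (n : ℕ) :
    0 ≤ Q.jumpTime ω n := clockSum_nonneg (Q.pathRates_pos _) hω n

@[fun_prop]
theorem measurable_jumpTime (n : ℕ) : Measurable fun ω => Q.jumpTime ω n := by
  have : Measurable Q.holdingRate := Measurable.of_discrete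
  unfold jumpTime clockSum pathRates
  fun_prop

theorem jumpIndex_eq (t : ℝ) (ω : (ℕ → E) × (ℕ → ℝ)) :
    Q.jumpIndex t ω = sInf {n : ℕ | t < Q.jumpTime ω (n + 1)} := rfl

theorem process_eq_of_mem_Ico {ω : (ℕ → E) × (ℕ → ℝ)} (hω : Monotone (Q.jumpTime ω)) {n : ℕ} {s : ℝ}
    (hs : s ∈ Set.Ico (Q.jumpTime ω n) (Q.jumpTime ω (n + 1))) : Q.process s ω = ω.1 n := by
  have hn : Q.jumpIndex s ω = n := by
    refine le_antisymm (Nat.sInf_le hs.2) (le_csInf ⟨n, hs.2⟩ fun m hm => ?_)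
    by_contra hmn
    exact absurd (hs.1.trans_lt hm) (not_lt.2 (hω (Nat.succ_le_of_lt (not_le.1 hmn))))
  rw [process, hn]

theorem measurable_jumpIndex :
    Measurable fun p : ((ℕ → E) × (ℕ → ℝ)) × ℝ => Q.jumpIndex p.2 p.1 := by
  have hm : ∀ n : ℕ, MeasurableSet {p : ((ℕ → E) × (ℕ → ℝ)) × ℝ | p.2 < Q.jumpTime p.1 (n + 1)} :=
    fun n => measurableSet_lt (by fun_prop) (by fun_prop)
  refine measurable_to_countable' fun n => ?_
  -- The second piece accounts for the convention `sInf ∅ = 0`: index `0` is also taken when no jump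
  -- time exceeds `t`.
  have hset : (fun p : ((ℕ → E) × (ℕ → ℝ)) × ℝ => Q.jumpIndex p.2 p.1) ⁻¹' {n} =
      ({p | p.2 < Q.jumpTime p.1 (n + 1)} ∩ ⋂ m ∈ Finset.range n,
        {p | p.2 < Q.jumpTime p.1 (m + 1)}ᶜ) ∪
      ({p | n = 0} ∩ ⋂ m, {p | p.2 < Q.jumpTime p.1 (m + 1)}ᶜ) := by
    ext p
    simp only [Set.mem_preimage, Set.mem_singleton_iff, jumpIndex_eq, Set.mem_union, Set.mem_inter_iff,
      Set.mem_iInter, Set.mem_compl_iff, Set.mem_ofPred_eq, Finset.mem_range]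
    constructor
    · intro h
      by_cases hne : {m : ℕ | p.2 < Q.jumpTime p.1 (m + 1)}.Nonempty
      · left
        have := Nat.sInf_mem hne
        rw [h] at this
        exact ⟨this, fun m hm => Nat.notMem_of_lt_sInf (by rwa [h])⟩
      · right
        rw [Set.not_nonempty_iff_eq_empty] at hne
        rw [hne, Nat.sInf_empty] at h
        exact ⟨h.symm, fun m hm => (hne ▸ (show m ∈ {m : ℕ | p.2 < Q.jumpTime p.1 (m + 1)} from hm) :
          m ∈ (∅ : Set ℕ))⟩
    · rintro (⟨h1, h2⟩ | ⟨h1, h2⟩)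
      · refine le_antisymm (Nat.sInf_le h1) (le_csInf ⟨n, h1⟩ fun m hm => ?_)
        by_contra hmn
        exact h2 m (not_le.1 hmn) hm
      · rw [h1, Set.eq_empty_of_forall_notMem (s := {m : ℕ | p.2 < Q.jumpTime p.1 (m + 1)}) h2,
          Nat.sInf_empty]
  rw [hset]
  exact ((hm n).inter (Finset.measurableSet_biInter _ fun m _ => (hm m).compl)).union
    ((MeasurableSet.const _).inter (MeasurableSet.iInter fun m => (hm m).compl))

theorem measurable_process :
    Measurable fun p : ((ℕ → E) × (ℕ → ℝ)) × ℝ => Q.process p.2 p.1 := by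
  have h : Measurable fun p : (ℕ → E) × ℕ => p.1 p.2 :=
    measurable_from_prod_countable_left fun n => measurable_pi_apply n
  exact h.comp (measurable_fst.fst.prodMk Q.measurable_jumpIndex)

theorem pathMeasure_eq (η : E) : Q.pathMeasure η = (Q.jumpChainLaw η).prod expSeq := rfl

instance (η : E) : IsProbabilityMeasure (Q.pathMeasure η) := by
  rw [pathMeasure_eq]; infer_instance

theorem ae_clocks_nonneg (η : E) : ∀ᵐ ω ∂Q.pathMeasure η, ∀ n, 0 ≤ ω.2 n := by
  have h : ∀ᵐ e ∂(Q.pathMeasure η).map Prod.snd, ∀ n, 0 ≤ e n := by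
    rw [pathMeasure_eq, Measure.map_snd_prod, measure_univ, one_smul]
    exact ae_expSeq_nonneg
  exact ae_of_ae_map measurable_snd.aemeasurable h

theorem lintegral_exp_neg_jumpTime (η : E) (n : ℕ) :
    ∫⁻ ω, ENNReal.ofReal (Real.exp (-Q.jumpTime ω n)) ∂Q.pathMeasure η =
      ∫⁻ y, ∏ i ∈ Finset.range n,
        ENNReal.ofReal (Q.holdingRate (y i) / (1 + Q.holdingRate (y i))) ∂Q.jumpChainLaw η := by
  rw [pathMeasure_eq, lintegral_prod _ (by fun_prop)]
  exact lintegral_congr fun y => lintegral_exp_neg_clockSum (Q.pathRates_pos y) n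

/-- A recurrent chain does not explode. -/
theorem ae_not_bddAbove_jumpTime (hrec : Q.IsRecurrent) (η : E) :
    ∀ᵐ ω ∂Q.pathMeasure η, ¬ BddAbove (Set.range (Q.jumpTime ω)) := by
  have hlim := Q.tendsto_lintegral_prod_weight hrec
    (c := fun x => ENNReal.ofReal (Q.holdingRate x / (1 + Q.holdingRate x))) (fun x => by
      have := Q.holdingRate_pos x
      rw [ENNReal.ofReal_lt_one, div_lt_one (by linarith)]
      linarith) η
  simp_rw [← lintegral_exp_neg_jumpTime] at hlim
  have hM : ∀ M : ℕ, Q.pathMeasure η {ω | ∀ n, Q.jumpTime ω n ≤ M} = 0 := by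
    intro M
    -- Markov's inequality for `exp (-S_n)`, with `S_n` the `n`-th jump time. Its mean is the
    -- survival probability of a chain killed at each visited `x` with probability `1 / (1 + λ(x))`.
    have hle : ∀ n, Q.pathMeasure η {ω | ∀ n, Q.jumpTime ω n ≤ M} ≤
        ENNReal.ofReal (Real.exp M) *
          ∫⁻ ω, ENNReal.ofReal (Real.exp (-Q.jumpTime ω n)) ∂Q.pathMeasure η := by
      intro n
      rw [← lintegral_const_mul _ (by fun_prop)]
      refine (measure_mono (t := {ω | 1 ≤ ENNReal.ofReal (Real.exp M) *
        ENNReal.ofReal (Real.exp (-Q.jumpTime ω n))}) fun ω hω => ?_).trans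
        ((mul_meas_ge_le_lintegral₀ (by fun_prop) 1).trans' (by rw [one_mul]))
      simp only [Set.mem_ofPred_eq] at hω ⊢
      rw [← ENNReal.ofReal_mul (Real.exp_pos _).le, ← Real.exp_add, ENNReal.one_le_ofReal,
        Real.one_le_exp_iff]
      linarith [hω n]
    have h0 := ENNReal.Tendsto.const_mul (a := ENNReal.ofReal (Real.exp M)) hlim
      (Or.inr ENNReal.ofReal_ne_top)
    rw [mul_zero] at h0
    exact le_antisymm (ge_of_tendsto' h0 hle) zero_le
  rw [ae_iff]
  refine measure_mono_null (t := ⋃ M : ℕ, {ω | ∀ n, Q.jumpTime ω n ≤ M}) (fun ω hω => ?_)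
    (measure_iUnion_null hM)
  obtain ⟨b, hb⟩ := not_not.1 hω
  obtain ⟨M, hM⟩ := exists_nat_ge b
  exact Set.mem_iUnion.2 ⟨M, fun n => (hb ⟨n, rfl⟩).trans hM⟩

/-- The probability that `n` jumps occur before `t`, given the path of the jump chain. -/
def jumpProbBefore (t : ℝ) (n : ℕ) (y : ℕ → E) : ℝ≥0∞ :=
  expSeq {e | clockSum (Q.pathRates y) e n ≤ t}

/-- The strict inequality matters: the probability of `n + 1` jumps by `t` does not involve `y (n +
1)`, so the Markov property at time `n` applies to it. -/
theorem jumpProbBefore_congr (t : ℝ) (n : ℕ) {y y' : ℕ → E} (h : ∀ i < n, y i = y' i) :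
    Q.jumpProbBefore t n y = Q.jumpProbBefore t n y' := by
  unfold jumpProbBefore clockSum pathRates
  congr 1
  ext e
  simp only [Set.mem_ofPred_eq]
  rw [Finset.sum_congr rfl fun i hi => by rw [h i (Finset.mem_range.1 hi)]]

theorem jumpProbBefore_le_one (t : ℝ) (n : ℕ) (y : ℕ → E) : Q.jumpProbBefore t n y ≤ 1 := prob_le_one

theorem jumpProbBefore_anti (t : ℝ) (y : ℕ → E) : Antitone fun n => Q.jumpProbBefore t n y := by
  intro m n hmn
  refine measure_mono_ae ?_
  filter_upwards [ae_expSeq_nonneg] with e he h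
  exact (clockSum_mono (Q.pathRates_pos y) he hmn).trans h

theorem jumpProbBefore_zero {t : ℝ} (ht : 0 ≤ t) (y : ℕ → E) : Q.jumpProbBefore t 0 y = 1 := by
  simp [jumpProbBefore, ht]

/-- The expected time integral `E_η[∫_0^t φ(η_s) ds]` of a nonnegative function. -/
def occupation (φ : E → ℝ≥0∞) (t : ℝ) (η : E) : ℝ≥0∞ :=
  ∫⁻ ω, (∫⁻ s in Set.Icc 0 t, φ (Q.process s ω)) ∂Q.pathMeasure η

/-- Without explosion the holding intervals tile `[0, ∞)`. For an interval starting after `t` the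
minimum is negative and `ENNReal.ofReal` makes its term zero. -/
theorem lintegral_process_eq_tsum (φ : E → ℝ≥0∞) (t : ℝ) {ω : (ℕ → E) × (ℕ → ℝ)}
    (hω : ∀ n, 0 ≤ ω.2 n) (hb : ¬ BddAbove (Set.range (Q.jumpTime ω))) :
    ∫⁻ s in Set.Icc 0 t, φ (Q.process s ω) =
      ∑' n, φ (ω.1 n) *
        ENNReal.ofReal (min (ω.2 n / Q.holdingRate (ω.1 n)) (t - Q.jumpTime ω n)) := by
  have hmono : Monotone (Q.jumpTime ω) := clockSum_mono (Q.pathRates_pos _) hω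
  have h0 : Q.jumpTime ω 0 = 0 := clockSum_zero _ _
  have hU : (⋃ n, Set.Ico (Q.jumpTime ω n) (Q.jumpTime ω (n + 1))) = Set.Ici 0 := by
    have := iUnion_Ico_map_succ_eq_Ici (f := Q.jumpTime ω) (fun a => hmono (Nat.zero_le a)) hb
    rw [Nat.bot_eq_zero, h0] at this
    exact this
  have hU' : Set.Icc 0 t =
      ⋃ n, Set.Ico (Q.jumpTime ω n) (Q.jumpTime ω (n + 1)) ∩ Set.Icc 0 t := by
    rw [← Set.iUnion_inter, hU]
    exact (Set.inter_eq_right.2 Set.Icc_subset_Ici_self).symm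
  rw [hU', lintegral_iUnion (fun n => measurableSet_Ico.inter measurableSet_Icc)]
  · refine tsum_congr fun n => ?_
    rw [setLIntegral_congr_fun (g := fun _ => φ (ω.1 n)) (measurableSet_Ico.inter measurableSet_Icc)
      (fun s hs => by rw [Q.process_eq_of_mem_Ico hmono hs.1]), setLIntegral_const,
      volume_Ico_inter_Icc (Q.jumpTime_nonneg hω n), jumpTime_succ,
      add_sub_cancel_left]
  · intro m n hmn
    exact (hmono.pairwise_disjoint_on_Ico_succ hmn).mono Set.inter_subset_left Set.inter_subset_left

theorem occupation_eq_tsum (hrec : Q.IsRecurrent) (φ : E → ℝ≥0∞) (t : ℝ) (η : E) :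
    Q.occupation φ t η = ∑' n, ∫⁻ y, φ (y n) * (ENNReal.ofReal (1 / Q.holdingRate (y n)) *
      Q.jumpProbBefore t (n + 1) y) ∂Q.jumpChainLaw η := by
  have mφ : Measurable φ := Measurable.of_discrete
  have mh : Measurable Q.holdingRate := Measurable.of_discrete
  have hm : ∀ n, Measurable fun ω : (ℕ → E) × (ℕ → ℝ) => φ (ω.1 n) *
        ENNReal.ofReal (min (ω.2 n / Q.holdingRate (ω.1 n)) (t - Q.jumpTime ω n)) := fun n => by
    fun_prop
  rw [occupation, lintegral_congr_ae (g := fun ω => ∑' n, φ (ω.1 n) *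
        ENNReal.ofReal (min (ω.2 n / Q.holdingRate (ω.1 n)) (t - Q.jumpTime ω n)))]
  · rw [lintegral_tsum fun n => (hm n).aemeasurable]
    refine tsum_congr fun n => ?_
    rw [pathMeasure_eq, lintegral_prod _ (hm n).aemeasurable]
    refine lintegral_congr fun y => ?_
    have hy : Measurable fun e : ℕ → ℝ => Q.jumpTime (y, e) n :=
      (Q.measurable_jumpTime n).comp measurable_prodMk_left
    simp only
    rw [lintegral_const_mul _ (by fun_prop)]
    congr 1
    exact lintegral_min_holding (Q.pathRates_pos y) t n
  · filter_upwards [Q.ae_clocks_nonneg η, Q.ae_not_bddAbove_jumpTime hrec η] with ω h1 h2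
    exact Q.lintegral_process_eq_tsum φ t h1 h2

/-- The part of `E_η[∫_0^{T_ξ} φ(η_s) ds]` coming from each holding interval. -/
theorem tsum_killed_le_lintegral_hittingTime (ξ η : E) (φ : E → ℝ≥0∞) (d : E → ℝ≥0∞)
    (hd : d = Set.indicator {ξ}ᶜ 1) :
    ∑' n, ∫⁻ y, (∏ i ∈ Finset.range (n + 1), d (y i)) *
        (φ (y n) * ENNReal.ofReal (1 / Q.holdingRate (y n))) ∂Q.jumpChainLaw η ≤
      ∫⁻ ω, (∫⁻ s in {s : ℝ | 0 ≤ s ∧ ENNReal.ofReal s < Q.hittingTime ξ ω},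
        φ (Q.process s ω)) ∂Q.pathMeasure η := by
  have mφ : Measurable φ := Measurable.of_discrete
  have md : Measurable d := Measurable.of_discrete
  have mh : Measurable Q.holdingRate := Measurable.of_discrete
  have hm : ∀ n, Measurable fun ω : (ℕ → E) × (ℕ → ℝ) =>
      (∏ i ∈ Finset.range (n + 1), d (ω.1 i)) *
        (φ (ω.1 n) * ENNReal.ofReal (ω.2 n / Q.holdingRate (ω.1 n))) := fun n => by
    fun_prop
  calc _ = ∫⁻ ω, ∑' n, (∏ i ∈ Finset.range (n + 1), d (ω.1 i)) *
        (φ (ω.1 n) * ENNReal.ofReal (ω.2 n / Q.holdingRate (ω.1 n))) ∂Q.pathMeasure η := by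
        rw [lintegral_tsum fun n => (hm n).aemeasurable]
        refine tsum_congr fun n => ?_
        rw [pathMeasure_eq, lintegral_prod _ (hm n).aemeasurable]
        refine lintegral_congr fun y => ?_
        simp only
        rw [lintegral_const_mul _ (by fun_prop), lintegral_const_mul _ (by fun_prop)]
        congr 2
        exact (lintegral_holding (Q.pathRates_pos y) n).symm
    _ ≤ _ := by
        refine lintegral_mono_ae ?_
        filter_upwards [Q.ae_clocks_nonneg η] with ω hω
        have hmono : Monotone (Q.jumpTime ω) := clockSum_mono (Q.pathRates_pos _) hω
        set I : ℕ → Set ℝ := fun n => {s | s ∈ Set.Ico (Q.jumpTime ω n) (Q.jumpTime ω (n + 1)) ∧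
          ∀ i ∈ Finset.range (n + 1), ω.1 i ≠ ξ} with hI
        have mI : ∀ n, MeasurableSet (I n) := fun n => measurableSet_Ico.inter (MeasurableSet.const _)
        -- Before the end of the `n`-th interval only the states with index at most `n` occur. If
        -- none is `ξ`, the hitting time is at least the end of that interval.
        have hsub : (⋃ n, I n) ⊆ {s : ℝ | 0 ≤ s ∧ ENNReal.ofReal s < Q.hittingTime ξ ω} := by
          refine Set.iUnion_subset fun n s hs => ?_
          have hs0 : 0 ≤ s := (Q.jumpTime_nonneg hω n).trans hs.1.1
          refine ⟨hs0, lt_of_lt_of_le ((ENNReal.ofReal_lt_ofReal_iff_of_nonneg hs0).2 hs.1.2)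
            (le_iInf fun t => le_iInf fun ht => ENNReal.ofReal_le_ofReal ?_)⟩
          by_contra hlt
          have hle : Q.jumpIndex t ω ≤ n := Nat.sInf_le (not_le.1 hlt)
          exact hs.2 _ (Finset.mem_range.2 (Nat.lt_succ_of_le hle)) ht.2
        refine le_trans ?_ (lintegral_mono_set hsub)
        rw [lintegral_iUnion mI]
        · refine ENNReal.tsum_le_tsum fun n => ?_
          by_cases hn : ∀ i ∈ Finset.range (n + 1), ω.1 i ≠ ξ
          · have hIn : I n = Set.Ico (Q.jumpTime ω n) (Q.jumpTime ω (n + 1)) := by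
              ext s
              exact and_iff_left hn
            rw [hIn, setLIntegral_congr_fun (g := fun _ => φ (ω.1 n)) measurableSet_Ico
              (fun s hs => by rw [Q.process_eq_of_mem_Ico hmono hs]), setLIntegral_const,
              Real.volume_Ico, jumpTime_succ, add_sub_cancel_left, Finset.prod_eq_one, one_mul]
            intro i hi
            rw [hd, Set.indicator_of_mem (by simpa using hn i hi)]
            rfl
          · push Not at hn
            obtain ⟨i, hi, hi'⟩ := hn
            rw [Finset.prod_eq_zero hi (by simp [hd, hi']), zero_mul]
            exact zero_le
        · intro m n hmn
          exact (hmono.pairwise_disjoint_on_Ico_succ hmn).mono (fun s hs => hs.1) (fun s hs => hs.1)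

end TransitionRates

/-! ### Potential theory of the chain killed at `ξ`, and the Poisson equation. -/

namespace TransitionRates

variable {E : Type*} [Countable E] [MeasurableSpace E] [DiscreteMeasurableSpace E]
  (Q : TransitionRates E)

/-- The indicator of the complement of `{ξ}`. -/
def avoid (ξ : E) : E → ℝ≥0∞ := Set.indicator {ξ}ᶜ 1

@[simp] theorem avoid_self (ξ : E) : avoid ξ ξ = 0 := by simp [avoid]

theorem avoid_of_ne {ξ η : E} (h : η ≠ ξ) : avoid ξ η = 1 := by simp [avoid, h]

/-- The potential of `ψ` for the jump chain killed at `ξ`. -/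
def killedPotential (ξ : E) (ψ : E → ℝ≥0∞) (η : E) : ℝ≥0∞ :=
  ∑' n, (Q.weightedStep (avoid ξ))^[n] (fun x => avoid ξ x * ψ x) η

theorem weightedStep_iterate_mono (c : E → ℝ≥0∞) (n : ℕ) : Monotone (Q.weightedStep c)^[n] :=
  (Q.weightedStep_mono c).iterate n

theorem killedPotential_mono (ξ : E) {ψ ψ' : E → ℝ≥0∞} (h : ψ ≤ ψ') (η : E) :
    Q.killedPotential ξ ψ η ≤ Q.killedPotential ξ ψ' η :=
  ENNReal.tsum_le_tsum fun n =>
    Q.weightedStep_iterate_mono _ n (fun x => mul_le_mul_right (h x) _) η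

/-- First-step analysis: the term `n = 0` is the present reward, the others restart after one jump.
-/
theorem killedPotential_eq (ξ : E) (ψ : E → ℝ≥0∞) (η : E) :
    Q.killedPotential ξ ψ η =
      avoid ξ η * (ψ η + ∫⁻ x, Q.killedPotential ξ ψ x ∂Q.jumpMeasure η) := by
  have : ∫⁻ x, Q.killedPotential ξ ψ x ∂Q.jumpMeasure η =
      ∑' n, ∫⁻ x, (Q.weightedStep (avoid ξ))^[n] (fun x => avoid ξ x * ψ x) x ∂Q.jumpMeasure η :=
    lintegral_tsum fun n => Measurable.of_discrete.aemeasurable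
  rw [this, mul_add, ← ENNReal.tsum_mul_left, killedPotential, tsum_eq_zero_add' ENNReal.summable]
  simp_rw [Function.iterate_succ_apply']
  rfl

theorem killedPotential_self (ξ : E) (ψ : E → ℝ≥0∞) : Q.killedPotential ξ ψ ξ = 0 := by
  rw [killedPotential_eq, avoid_self, zero_mul]

theorem killedPotential_of_ne {ξ η : E} (h : η ≠ ξ) (ψ : E → ℝ≥0∞) :
    Q.killedPotential ξ ψ η = ψ η + ∫⁻ x, Q.killedPotential ξ ψ x ∂Q.jumpMeasure η := by
  rw [killedPotential_eq, avoid_of_ne h, one_mul]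

/-- The killed potential is the minimal nonnegative supersolution. -/
theorem killedPotential_le (ξ : E) (ψ H : E → ℝ≥0∞)
    (hH : ∀ η, η ≠ ξ → ψ η + ∫⁻ x, H x ∂Q.jumpMeasure η ≤ H η) (η : E) :
    Q.killedPotential ξ ψ η ≤ H η := by
  refine ENNReal.tsum_le_of_sum_range_le fun N => ?_
  induction N generalizing η with
  | zero => simp
  | succ N ih =>
    rw [Finset.sum_range_succ']
    by_cases hη : η = ξ
    · simp [hη, Function.iterate_succ_apply', weightedStep]
    · refine le_trans (le_of_eq ?_) ((add_le_add_right (lintegral_mono ih) (ψ η)).trans (hH η hη))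
      rw [lintegral_finsetSum _ fun n _ => Measurable.of_discrete, add_comm]
      simp [Function.iterate_succ_apply', weightedStep, avoid_of_ne hη]

/-- Maximum principle. -/
theorem killedPotential_le_of_support {ξ : E} {ψ : E → ℝ≥0∞} {A : Set E}
    (hA : ∀ η ∉ A, ψ η = 0) {C : ℝ≥0∞} (hC : ∀ η ∈ A, Q.killedPotential ξ ψ η ≤ C) (η : E) :
    Q.killedPotential ξ ψ η ≤ C := by
  -- The potential truncated at `C` is still a supersolution: on `A` it equals the potential, and
  -- off `A` there is no reward, only an average of values at most `C`. Minimality concludes.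
  refine (Q.killedPotential_le ξ ψ (fun x => min (Q.killedPotential ξ ψ x) C)
    (fun x hx => ?_) η).trans (min_le_right _ _)
  have h1 : ψ x + ∫⁻ z, min (Q.killedPotential ξ ψ z) C ∂Q.jumpMeasure x ≤
      Q.killedPotential ξ ψ x := by
    rw [Q.killedPotential_of_ne hx]
    exact add_le_add_right (lintegral_mono fun z => min_le_left _ _) _
  refine le_min h1 ?_
  by_cases hxA : x ∈ A
  · exact h1.trans (hC x hxA)
  · rw [hA x hxA, zero_add]
    exact (lintegral_mono fun z => min_le_right _ _).trans (by simp)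

theorem killedPotential_le_expAbsIntegralUntilHit (g : E → ℝ) (ξ η : E) :
    Q.killedPotential ξ (fun x => ENNReal.ofReal |g x| * ENNReal.ofReal (1 / Q.holdingRate x)) η ≤
      Q.expAbsIntegralUntilHit g ξ η := by
  refine le_trans (le_of_eq ?_) (Q.tsum_killed_le_lintegral_hittingTime ξ η
    (fun x => ENNReal.ofReal |g x|) (avoid ξ) rfl)
  refine tsum_congr fun n => ?_
  rw [← lintegral_prod_weight]
  refine lintegral_congr fun y => ?_
  rw [Finset.prod_range_succ, mul_assoc]

/-- A bounded solution, off `ξ`, of the Poisson equation. -/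
theorem exists_poisson_solution (g : E → ℝ) (ξ : E) {A : Set E} (hA : ∀ η, g η ≠ 0 → η ∈ A)
    {C : ℝ≥0∞} (hC : C ≠ ∞) (hgC : ∀ η ∈ A, Q.expAbsIntegralUntilHit g ξ η ≤ C) :
    ∃ f : E → ℝ, (∀ η, |f η| ≤ C.toReal) ∧ f ξ = 0 ∧
      ∀ η, η ≠ ξ → f η - ∫ x, f x ∂Q.jumpMeasure η = g η / Q.holdingRate η := by
  -- `ENNReal.ofReal` keeps only the positive part of `h`, so the signed potential of `g` will be `F
  -- g - F (-g)`.
  set F : (E → ℝ) → E → ℝ≥0∞ := fun h => Q.killedPotential ξ fun x =>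
    ENNReal.ofReal (h x) * ENNReal.ofReal (1 / Q.holdingRate x) with hF
  have habs : ∀ η, F (fun x => |g x|) η ≤ C := by
    refine Q.killedPotential_le_of_support (A := A) (fun η hη => ?_) fun η hη =>
      (Q.killedPotential_le_expAbsIntegralUntilHit g ξ η).trans (hgC η hη)
    have : g η = 0 := by
      by_contra h
      exact hη (hA η h)
    simp [this]
  have hle : ∀ h : E → ℝ, (∀ x, h x ≤ |g x|) → ∀ η, F h η ≤ C := fun h hh η =>
    (Q.killedPotential_mono ξ (fun x => mul_le_mul_left (ENNReal.ofReal_le_ofReal (hh x)) _) η).trans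
      (habs η)
  have hreal : ∀ h : E → ℝ, (∀ x, h x ≤ |g x|) → ∀ η, (F h η).toReal ≤ C.toReal :=
    fun h hh η => ENNReal.toReal_mono hC (hle h hh η)
  have heq : ∀ h : E → ℝ, (∀ x, h x ≤ |g x|) → ∀ η, η ≠ ξ →
      (F h η).toReal = max (h η) 0 / Q.holdingRate η + ∫ x, (F h x).toReal ∂Q.jumpMeasure η := by
    intro h hh η hη
    rw [integral_toReal Measurable.of_discrete.aemeasurable
      (Filter.Eventually.of_forall fun x => (hle h hh x).trans_lt hC.lt_top),
      show F h η = _ + ∫⁻ x, F h x ∂Q.jumpMeasure η from Q.killedPotential_of_ne hη _,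
      ENNReal.toReal_add (by finiteness)]
    · rw [ENNReal.toReal_mul, ENNReal.toReal_ofReal', ENNReal.toReal_ofReal
        (one_div_nonneg.2 (Q.holdingRate_pos η).le), mul_one_div]
    · exact ((lintegral_mono (hle h hh)).trans_lt (by simpa using hC.lt_top)).ne
  have hp : ∀ x, g x ≤ |g x| := fun x => le_abs_self _
  have hn : ∀ x, -g x ≤ |g x| := fun x => neg_le_abs _
  have hint : ∀ h : E → ℝ, (∀ x, h x ≤ |g x|) → ∀ η,
      Integrable (fun x => (F h x).toReal) (Q.jumpMeasure η) := fun h hh η =>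
    Integrable.of_bound Measurable.of_discrete.aestronglyMeasurable C.toReal
      (Filter.Eventually.of_forall fun x => by
        rw [Real.norm_of_nonneg ENNReal.toReal_nonneg]
        exact hreal h hh x)
  refine ⟨fun η => (F g η).toReal - (F (fun x => -g x) η).toReal, fun η => ?_, ?_, fun η hη => ?_⟩
  -- Both potentials lie in `[0, C]`, so their difference is bounded by `C` rather than `2 * C`; the
  -- final constant `2` depends on this.
  · exact abs_sub_le_of_nonneg_of_le ENNReal.toReal_nonneg (hreal _ hp η) ENNReal.toReal_nonneg
      (hreal _ hn η)
  · simp [hF, killedPotential_self]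
  · simp only
    rw [integral_sub (hint _ hp η) (hint _ hn η), heq _ hp η hη, heq _ hn η hη,
      add_sub_add_comm, add_sub_cancel_right, ← sub_div]
    congr 1
    exact max_zero_sub_max_neg_zero_eq_self _

end TransitionRates

/-! ### Summation by parts and Dynkin's formula. -/

theorem abs_sum_range_sub_mul_le {F a : ℕ → ℝ} {C : ℝ} (hF : ∀ n, |F n| ≤ C) (ha : Antitone a)
    (ha0 : ∀ n, 0 ≤ a n) (N : ℕ) :
    |∑ n ∈ Finset.range N, (F n - F (n + 1)) * a (n + 1)| ≤ 2 * C * a 0 := by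
  -- With the boundary term kept, each step costs `C * (a N - a (N + 1))`, which telescopes;
  -- removing it at the end costs `C * a N`.
  have key : |∑ n ∈ Finset.range N, (F n - F (n + 1)) * a (n + 1) + F N * a N| ≤
      C * (2 * a 0 - a N) := by
    induction N with
    | zero =>
      simp only [Finset.range_zero, Finset.sum_empty, zero_add, abs_mul, abs_of_nonneg (ha0 0)]
      have := mul_le_mul_of_nonneg_right (hF 0) (ha0 0)
      linarith
    | succ N ih =>
      have h1 : ∑ n ∈ Finset.range (N + 1), (F n - F (n + 1)) * a (n + 1) + F (N + 1) * a (N + 1) =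
          (∑ n ∈ Finset.range N, (F n - F (n + 1)) * a (n + 1) + F N * a N) -
            F N * (a N - a (N + 1)) := by
        rw [Finset.sum_range_succ]; ring
      have h2 : 0 ≤ a N - a (N + 1) := sub_nonneg.2 (ha N.le_succ)
      have h3 : |F N * (a N - a (N + 1))| ≤ C * (a N - a (N + 1)) := by
        rw [abs_mul, abs_of_nonneg h2]
        exact mul_le_mul_of_nonneg_right (hF N) h2
      rw [h1]
      linarith [abs_sub (∑ n ∈ Finset.range N, (F n - F (n + 1)) * a (n + 1) + F N * a N)
        (F N * (a N - a (N + 1)))]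
  have h3 : |F N * a N| ≤ C * a N := by
    rw [abs_mul, abs_of_nonneg (ha0 N)]
    exact mul_le_mul_of_nonneg_right (hF N) (ha0 N)
  have h4 := abs_sub (∑ n ∈ Finset.range N, (F n - F (n + 1)) * a (n + 1) + F N * a N) (F N * a N)
  rw [add_sub_cancel_right] at h4
  linarith

namespace TransitionRates

variable {E : Type*} [Countable E] [MeasurableSpace E] [DiscreteMeasurableSpace E]
  (Q : TransitionRates E)

theorem measurable_jumpProbBefore (t : ℝ) (n : ℕ) : Measurable (Q.jumpProbBefore t n) := by
  obtain ⟨G', hG'⟩ := exists_factor_frestrictLe (G := Q.jumpProbBefore t n) (n := n)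
    fun y y' h => Q.jumpProbBefore_congr t n fun i hi => h i hi.le
  have h : Measurable G' := Measurable.of_discrete
  rw [funext hG']
  exact h.comp (by fun_prop)

theorem occupation_eq_lintegral_prod (φ : E → ℝ≥0∞) (t : ℝ) (η : E) :
    Q.occupation φ t η = ∫⁻ p, φ (Q.process p.2 p.1)
      ∂((Q.pathMeasure η).prod (volume.restrict (Set.Icc 0 t))) :=
  (lintegral_prod (fun p : ((ℕ → E) × (ℕ → ℝ)) × ℝ => φ (Q.process p.2 p.1))
    ((Measurable.of_discrete (f := φ)).comp Q.measurable_process).aemeasurable).symm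

theorem occupation_eq_lintegral_measure (φ : E → ℝ≥0∞) (t : ℝ) (η : E) :
    Q.occupation φ t η = ∫⁻ s in Set.Icc 0 t,
      ∑' ζ, φ ζ * Q.pathMeasure η {ω | Q.process s ω = ζ} := by
  have hm := (Measurable.of_discrete (f := φ)).comp Q.measurable_process
  rw [occupation, lintegral_lintegral_swap (f := fun ω s => φ (Q.process s ω)) hm.aemeasurable]
  refine lintegral_congr fun s => ?_
  have hs : Measurable (Q.process s) := Q.measurable_process.comp measurable_prodMk_right
  rw [← lintegral_map Measurable.of_discrete hs, lintegral_countable']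
  refine tsum_congr fun ζ => ?_
  rw [Measure.map_apply hs MeasurableSet.of_discrete]
  rfl

theorem timeIntegrable_of_occupation {g : E → ℝ} {t : ℝ} {η : E}
    (h : Q.occupation (fun x => ENNReal.ofReal |g x|) t η < ∞) : Q.TimeIntegrable g t η := by
  refine ⟨((Measurable.of_discrete (f := g)).comp Q.measurable_process).aestronglyMeasurable, ?_⟩
  rw [occupation_eq_lintegral_prod] at h
  rw [hasFiniteIntegral_iff_norm]
  exact h

theorem occupation_lt_top_of_timeIntegrable {g : E → ℝ} {t : ℝ} {η : E}
    (h : Q.TimeIntegrable g t η) : Q.occupation (fun x => ENNReal.ofReal |g x|) t η < ∞ := by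
  rw [occupation_eq_lintegral_prod]
  exact (hasFiniteIntegral_iff_norm _).1 h.2

theorem occupation_mono {φ φ' : E → ℝ≥0∞} (h : φ ≤ φ') (t : ℝ) (η : E) :
    Q.occupation φ t η ≤ Q.occupation φ' t η :=
  lintegral_mono fun _ => lintegral_mono fun _ => h _

theorem occupation_ofReal_lt_top {g : E → ℝ} {t : ℝ} {η : E} (h : Q.TimeIntegrable g t η) :
    Q.occupation (fun x => ENNReal.ofReal (g x)) t η < ∞ :=
  (Q.occupation_mono (fun x => ENNReal.ofReal_le_ofReal (le_abs_self (g x))) t η).trans_lt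
    (Q.occupation_lt_top_of_timeIntegrable h)

theorem TimeIntegrable.neg {Q : TransitionRates E} {g : E → ℝ} {t : ℝ} {η : E}
    (h : Q.TimeIntegrable g t η) : Q.TimeIntegrable (fun x => -g x) t η := Integrable.neg h

theorem expTimeIntegral_eq_integral_prod {g : E → ℝ} {t : ℝ} (ht : 0 ≤ t) {η : E}
    (h : Q.TimeIntegrable g t η) :
    Q.expTimeIntegral g t η = ∫ p, g (Q.process p.2 p.1)
      ∂((Q.pathMeasure η).prod (volume.restrict (Set.Icc 0 t))) := by
  rw [integral_prod _ h, expTimeIntegral]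
  simp_rw [intervalIntegral.integral_of_le ht, integral_Icc_eq_integral_Ioc]

theorem expTimeIntegral_eq_sub {g : E → ℝ} {t : ℝ} (ht : 0 ≤ t) {η : E}
    (h : Q.TimeIntegrable g t η) :
    Q.expTimeIntegral g t η = (Q.occupation (fun x => ENNReal.ofReal (g x)) t η).toReal -
      (Q.occupation (fun x => ENNReal.ofReal (-g x)) t η).toReal := by
  rw [Q.expTimeIntegral_eq_integral_prod ht h, integral_eq_lintegral_pos_part_sub_lintegral_neg_part h,
    occupation_eq_lintegral_prod, occupation_eq_lintegral_prod]

/-- The expansion over holding intervals is applied to the positive and negative parts, both finite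
by time integrability. The bound on `g / λ` makes each term integrable, so the parts recombine. -/
theorem hasSum_expTimeIntegral (hrec : Q.IsRecurrent) {g : E → ℝ} {t : ℝ} (ht : 0 ≤ t) {η : E}
    (h : Q.TimeIntegrable g t η) {B : ℝ} (hB : ∀ x, |g x / Q.holdingRate x| ≤ B) :
    HasSum (fun n => ∫ y, (Q.jumpProbBefore t (n + 1) y).toReal * (g (y n) / Q.holdingRate (y n))
      ∂Q.jumpChainLaw η) (Q.expTimeIntegral g t η) := by
  have hpos : ∀ g : E → ℝ, Q.TimeIntegrable g t η →
      HasSum (fun n => (∫⁻ y, ENNReal.ofReal ((Q.jumpProbBefore t (n + 1) y).toReal *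
        (g (y n) / Q.holdingRate (y n))) ∂Q.jumpChainLaw η).toReal)
        (Q.occupation (fun x => ENNReal.ofReal (g x)) t η).toReal := by
    intro g h
    have hfin := (Q.occupation_ofReal_lt_top h).ne
    rw [Q.occupation_eq_tsum hrec] at hfin ⊢
    convert ENNReal.hasSum_toReal hfin using 1
    · funext n
      congr 1
      refine lintegral_congr fun y => ?_
      rw [ENNReal.ofReal_mul ENNReal.toReal_nonneg, ENNReal.ofReal_toReal
        ((Q.jumpProbBefore_le_one t (n + 1) y).trans_lt ENNReal.one_lt_top).ne, div_eq_mul_one_div,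
        ENNReal.ofReal_mul' (one_div_nonneg.2 (Q.holdingRate_pos _).le)]
      ring
    · rw [ENNReal.tsum_toReal_eq fun n => ENNReal.ne_top_of_tsum_ne_top hfin n]
  rw [Q.expTimeIntegral_eq_sub ht h]
  refine ((hpos g h).sub (hpos _ h.neg)).congr_fun fun n => ?_
  have mg : Measurable fun x => g x / Q.holdingRate x := Measurable.of_discrete
  have ma := Q.measurable_jumpProbBefore t (n + 1)
  rw [integral_eq_lintegral_pos_part_sub_lintegral_neg_part]
  · simp_rw [neg_div, mul_neg]
  · refine Integrable.of_bound (Measurable.aestronglyMeasurable (by fun_prop)) B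
      (Filter.Eventually.of_forall fun y => ?_)
    rw [Real.norm_eq_abs, abs_mul, abs_of_nonneg ENNReal.toReal_nonneg]
    refine (mul_le_of_le_one_left (abs_nonneg _) ?_).trans (hB _)
    exact ENNReal.toReal_le_of_le_ofReal zero_le_one
      (by simpa using Q.jumpProbBefore_le_one t (n + 1) y)

/-- Dynkin's formula for a bounded solution of the Poisson equation, as a bound. -/
theorem abs_expTimeIntegral_le (hrec : Q.IsRecurrent) {f g : E → ℝ} {C : ℝ} (hf : ∀ x, |f x| ≤ C)
    (hfg : ∀ x, f x - ∫ z, f z ∂Q.jumpMeasure x = g x / Q.holdingRate x) {t : ℝ} (ht : 0 ≤ t)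
    {η : E} (h : Q.TimeIntegrable g t η) : |Q.expTimeIntegral g t η| ≤ 2 * C := by
  have hP : ∀ x, |∫ z, f z ∂Q.jumpMeasure x| ≤ C := fun x => by
    have := norm_integral_le_of_norm_le_const (μ := Q.jumpMeasure x) (f := f) (C := C)
      (Filter.Eventually.of_forall hf)
    simpa using this
  have hB : ∀ x, |g x / Q.holdingRate x| ≤ C + C := fun x => by
    rw [← hfg]
    exact (abs_sub _ _).trans (add_le_add (hf x) (hP x))
  have hsum := Q.hasSum_expTimeIntegral hrec ht h hB
  refine le_of_tendsto' (hsum.tendsto_sum_nat.abs) fun N => ?_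
  set a : ℕ → (ℕ → E) → ℝ := fun n y => (Q.jumpProbBefore t n y).toReal with ha
  have ma : ∀ n, Measurable (a n) := fun n => (Q.measurable_jumpProbBefore t n).ennreal_toReal
  have mf : Measurable f := Measurable.of_discrete
  have mP : Measurable fun x => ∫ z, f z ∂Q.jumpMeasure x := Measurable.of_discrete
  have a1 : ∀ n y, |a n y| ≤ 1 := fun n y => by
    rw [abs_of_nonneg ENNReal.toReal_nonneg]
    exact ENNReal.toReal_le_of_le_ofReal zero_le_one (by simpa using Q.jumpProbBefore_le_one t n y)
  have hint : ∀ n (k : E → ℝ) m, (∀ x, |k x| ≤ C) →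
      Integrable (fun y => a n y * k (y m)) (Q.jumpChainLaw η) := fun n k m hk => by
    have mk : Measurable k := Measurable.of_discrete
    refine Integrable.of_bound (Measurable.aestronglyMeasurable (by fun_prop)) C
      (Filter.Eventually.of_forall fun y => ?_)
    rw [Real.norm_eq_abs, abs_mul]
    exact (mul_le_of_le_one_left (abs_nonneg _) (a1 n y)).trans (hk _)
  -- By the Poisson equation and the Markov property at time `n`, the average of `f` after a jump
  -- from `y n` is replaced by `f (y (n + 1))`.
  have hterm : ∀ n, ∫ y, a (n + 1) y * (g (y n) / Q.holdingRate (y n)) ∂Q.jumpChainLaw η =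
      ∫ y, (f (y n) - f (y (n + 1))) * a (n + 1) y ∂Q.jumpChainLaw η := by
    intro n
    simp_rw [← hfg, mul_sub, sub_mul, mul_comm (f _) (a _ _)]
    rw [integral_sub (hint _ f _ hf) (hint _ (fun x => ∫ z, f z ∂Q.jumpMeasure x) _ hP),
      integral_sub (hint _ f _ hf) (hint _ f _ hf),
      Q.integral_jumpChainLaw_succ η n (G := a (n + 1)) (fun y y' hy => ?_) (a1 (n + 1)) hf]
    simp only [ha]
    rw [Q.jumpProbBefore_congr t (n + 1) fun i hi => hy i (Nat.lt_succ_iff.1 hi)]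
  have hint' : ∀ n, Integrable (fun y => (f (y n) - f (y (n + 1))) * a (n + 1) y)
      (Q.jumpChainLaw η) := fun n => by
    simp_rw [sub_mul, mul_comm (f _) (a _ _)]
    exact (hint _ f _ hf).sub (hint _ f _ hf)
  rw [Finset.sum_congr rfl fun n _ => hterm n, ← integral_finsetSum _ fun n _ => hint' n]
  have := norm_integral_le_of_norm_le_const (μ := Q.jumpChainLaw η)
    (f := fun y => ∑ n ∈ Finset.range N, (f (y n) - f (y (n + 1))) * a (n + 1) y) (C := 2 * C)
    (Filter.Eventually.of_forall fun y => by
      have hanti : Antitone fun n => a n y := fun m n hmn =>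
        ENNReal.toReal_mono ((Q.jumpProbBefore_le_one t m y).trans_lt ENNReal.one_lt_top).ne
          (Q.jumpProbBefore_anti t y hmn)
      have h0 : a 0 y = 1 := by simp [ha, Q.jumpProbBefore_zero ht]
      have := abs_sum_range_sub_mul_le (F := fun n => f (y n)) (fun n => hf _) hanti
        (fun n => ENNReal.toReal_nonneg) N
      rwa [h0, mul_one] at this)
  simpa using this

/-! ### Consequences of invariance, and removal of the defect at `ξ`. -/

section Invariant

variable {μ : Measure E} [IsProbabilityMeasure μ]

theorem lintegral_occupation (hμ : Q.IsInvariant μ) (φ : E → ℝ≥0∞) (t : ℝ) :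
    ∫⁻ η, Q.occupation φ t η ∂μ = ENNReal.ofReal t * ∫⁻ x, φ x ∂μ := by
  have hm : ∀ η ζ, Measurable fun s => Q.pathMeasure η {ω | Q.process s ω = ζ} := fun η ζ =>
    measurable_measure_prodMk_right (μ := Q.pathMeasure η)
      (s := {p : ((ℕ → E) × (ℕ → ℝ)) × ℝ | Q.process p.2 p.1 = ζ})
      (Q.measurable_process (MeasurableSet.of_discrete (s := {ζ})))
  have hm' : ∀ η, Measurable fun s => ∑' ζ, φ ζ * Q.pathMeasure η {ω | Q.process s ω = ζ} :=
    fun η => Measurable.tsum fun ζ => (hm η ζ).const_mul _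
  rw [lintegral_countable']
  have hmul : ∀ η, Q.occupation φ t η * μ {η} = ∫⁻ s in Set.Icc 0 t,
      (∑' ζ, φ ζ * Q.pathMeasure η {ω | Q.process s ω = ζ}) * μ {η} := fun η => by
    rw [occupation_eq_lintegral_measure, lintegral_mul_const _ (hm' η)]
  simp_rw [hmul]
  rw [← lintegral_tsum fun η => ((hm' η).mul_const _).aemeasurable,
    setLIntegral_congr_fun (g := fun _ => ∫⁻ x, φ x ∂μ) measurableSet_Icc fun s hs => ?_,
    setLIntegral_const, Real.volume_Icc, sub_zero, mul_comm]
  simp_rw [← ENNReal.tsum_mul_right]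
  rw [ENNReal.tsum_comm, lintegral_countable']
  refine tsum_congr fun ζ => ?_
  rw [← hμ s hs.1 ζ, ← ENNReal.tsum_mul_left]
  exact tsum_congr fun η => by ring

/-- The jump chain is at `ξ` at some step `n` with positive probability, and the finite jump time
ending that visit is below some integer `t`. -/
theorem exists_occupation_pos (hrec : Q.IsRecurrent) (hirr : Q.IsIrreducible) (η ξ : E) :
    ∃ t : ℝ, Q.occupation (Set.indicator {ξ} 1) t η ≠ 0 := by
  by_contra! hzero
  obtain ⟨n, hn⟩ := hirr η ξ
  have hae : ∀ t : ℕ, ∀ᵐ y ∂Q.jumpChainLaw η, y n = ξ → Q.jumpProbBefore t (n + 1) y = 0 := by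
    intro t
    have h := hzero t
    rw [Q.occupation_eq_tsum hrec, ENNReal.tsum_eq_zero] at h
    have m1 : Measurable (Set.indicator {ξ} 1 : E → ℝ≥0∞) := Measurable.of_discrete
    have m2 : Measurable Q.holdingRate := Measurable.of_discrete
    have m3 := Q.measurable_jumpProbBefore t (n + 1)
    have h2 := (lintegral_eq_zero_iff (by fun_prop)).1 (h n)
    filter_upwards [h2] with y hy hyn
    have hr := Q.holdingRate_pos (y n)
    simpa [hyn ▸ hr, hyn] using hy
  have hnull : ∀ᵐ y ∂Q.jumpChainLaw η, y n ≠ ξ := by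
    filter_upwards [ae_all_iff.2 hae] with y hy hyn
    have hU : (⋃ t : ℕ, {e | clockSum (Q.pathRates y) e (n + 1) ≤ t}) = Set.univ := by
      ext e
      simpa using exists_nat_ge _
    have h0 : expSeq (⋃ t : ℕ, {e | clockSum (Q.pathRates y) e (n + 1) ≤ t}) = 0 :=
      measure_iUnion_null fun t => hy t hyn
    rw [hU, measure_univ] at h0
    exact one_ne_zero h0
  rw [ae_iff] at hnull
  simp only [ne_eq, not_not] at hnull
  exact hn.ne' hnull

/-- If `μ {ξ} = 0`, the `μ`-mean occupation of `ξ` vanishes for every `t`; as every state has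
positive occupation of `ξ` for some `t`, no state carries mass. -/
theorem measure_singleton_ne_zero (hrec : Q.IsRecurrent) (hirr : Q.IsIrreducible)
    (hμ : Q.IsInvariant μ) (ξ : E) : μ {ξ} ≠ 0 := by
  intro h0
  have hall : ∀ η, μ {η} = 0 := by
    intro η
    obtain ⟨t, ht⟩ := Q.exists_occupation_pos hrec hirr η ξ
    have h := Q.lintegral_occupation hμ (Set.indicator {ξ} 1) t
    rw [lintegral_indicator_one MeasurableSet.of_discrete, h0, mul_zero, lintegral_countable',
      ENNReal.tsum_eq_zero] at h
    exact (mul_eq_zero.1 (h η)).resolve_left ht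
  have : μ Set.univ = 0 := by
    rw [← Set.biUnion_of_singleton Set.univ]
    exact (measure_biUnion_null_iff (Set.to_countable _)).2 fun η _ => hall η
  rw [measure_univ] at this
  exact one_ne_zero this

/-- The `μ`-average of the occupations of `|g|` is finite, and every state has positive mass, so
each occupation is finite. -/
theorem timeIntegrable (hrec : Q.IsRecurrent) (hirr : Q.IsIrreducible) (hμ : Q.IsInvariant μ)
    {g : E → ℝ} (hg : Integrable g μ) (t : ℝ) (η : E) : Q.TimeIntegrable g t η := by
  refine Q.timeIntegrable_of_occupation ?_
  have h := Q.lintegral_occupation hμ (fun x => ENNReal.ofReal |g x|) t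
  have hfin : ENNReal.ofReal t * ∫⁻ x, ENNReal.ofReal |g x| ∂μ < ∞ :=
    ENNReal.mul_lt_top ENNReal.ofReal_lt_top ((hasFiniteIntegral_iff_norm g).1 hg.2)
  rw [← h, lintegral_countable'] at hfin
  have := ENNReal.ne_top_of_tsum_ne_top hfin.ne η
  by_contra htop
  rw [not_lt_top_iff.1 htop, ENNReal.top_mul (Q.measure_singleton_ne_zero hrec hirr hμ η)] at this
  exact this rfl

theorem integral_expTimeIntegral (hrec : Q.IsRecurrent) (hirr : Q.IsIrreducible)
    (hμ : Q.IsInvariant μ) {g : E → ℝ} (hg : Integrable g μ) {t : ℝ} (ht : 0 ≤ t) :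
    ∫ η, Q.expTimeIntegral g t η ∂μ = t * ∫ x, g x ∂μ := by
  have hti := Q.timeIntegrable hrec hirr hμ hg t
  have hfin : ∀ h : E → ℝ, Integrable h μ →
      ∫⁻ η, Q.occupation (fun x => ENNReal.ofReal (h x)) t η ∂μ ≠ ∞ := fun h hh => by
    rw [Q.lintegral_occupation hμ]
    refine ENNReal.mul_ne_top ENNReal.ofReal_ne_top (ne_top_of_le_ne_top
      ((hasFiniteIntegral_iff_norm h).1 hh.2).ne (lintegral_mono fun x => ?_))
    exact ENNReal.ofReal_le_ofReal (le_abs_self _)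
  have hint : ∀ h : E → ℝ, Integrable h μ →
      Integrable (fun η => (Q.occupation (fun x => ENNReal.ofReal (h x)) t η).toReal) μ :=
    fun h hh => integrable_toReal_of_lintegral_ne_top Measurable.of_discrete.aemeasurable (hfin h hh)
  have hval : ∀ h : E → ℝ, Integrable h μ →
      ∫ η, (Q.occupation (fun x => ENNReal.ofReal (h x)) t η).toReal ∂μ =
        t * (∫⁻ x, ENNReal.ofReal (h x) ∂μ).toReal := fun h hh => by
    rw [integral_toReal Measurable.of_discrete.aemeasurable
      (ae_lt_top Measurable.of_discrete (hfin h hh)), Q.lintegral_occupation hμ,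
      ENNReal.toReal_mul, ENNReal.toReal_ofReal ht]
  simp_rw [fun η => Q.expTimeIntegral_eq_sub ht (hti η)]
  have hneg : Integrable (fun x => -g x) μ := hg.neg
  rw [integral_sub (hint g hg) (hint _ hneg), hval g hg, hval _ hneg,
    integral_eq_lintegral_pos_part_sub_lintegral_neg_part hg, mul_sub]

/-- The bound for a function vanishing off `A`, with an arbitrary reference state. -/
theorem iSup_abs_expTimeIntegral_le (hrec : Q.IsRecurrent) (hirr : Q.IsIrreducible)
    (hμ : Q.IsInvariant μ) {g : E → ℝ} (hg : Integrable g μ) (hg0 : ∫ η, g η ∂μ = 0) (ξ : E)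
    {A : Set E} (hA : ∀ η, g η ≠ 0 → η ∈ A) {t : ℝ} (ht : 0 < t) :
    (⨆ η, ENNReal.ofReal |Q.expTimeIntegral g t η|) ≤
      2 * ⨆ η ∈ A, Q.expAbsIntegralUntilHit g ξ η := by
  classical
  set C := ⨆ η ∈ A, Q.expAbsIntegralUntilHit g ξ η with hC
  by_cases hCt : C = ∞
  · rw [hCt, ENNReal.mul_top two_ne_zero]
    exact le_top
  obtain ⟨f, hf, hfξ, hfeq⟩ := Q.exists_poisson_solution g ξ hA hCt
    fun η hη => le_iSup₂ (f := fun η (_ : η ∈ A) => Q.expAbsIntegralUntilHit g ξ η) η hη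
  -- The defect of the Poisson equation at `ξ`, where `f` vanishes. Subtracting `ε * λ(ξ)` from `g`
  -- at `ξ` repairs the equation.
  set ε := g ξ / Q.holdingRate ξ + ∫ x, f x ∂Q.jumpMeasure ξ with hε
  have hξ := Q.holdingRate_pos ξ
  set g' : E → ℝ := fun x => g x - ({ξ} : Set E).indicator (fun _ => ε * Q.holdingRate ξ) x with hg'
  have hindint : Integrable (({ξ} : Set E).indicator fun _ => ε * Q.holdingRate ξ) μ :=
    (integrable_const _).indicator MeasurableSet.of_discrete
  have hg'int : Integrable g' μ := hg.sub hindint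
  have heq : ∀ x, f x - ∫ z, f z ∂Q.jumpMeasure x = g' x / Q.holdingRate x := by
    intro x
    by_cases hx : x = ξ
    · subst hx
      simp only [hg', Set.indicator_of_mem (Set.mem_singleton x), hfξ, hε]
      field_simp
      ring
    · have hx' : x ∉ ({ξ} : Set E) := hx
      simp only [hg', Set.indicator_of_notMem hx', sub_zero]
      exact hfeq x hx
  have hbound : ∀ s, 0 ≤ s → ∀ η, |Q.expTimeIntegral g' s η| ≤ 2 * C.toReal := fun s hs η =>
    Q.abs_expTimeIntegral_le hrec hf heq hs (Q.timeIntegrable hrec hirr hμ hg'int s η)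
  have hint' : ∫ x, g' x ∂μ = -(μ.real {ξ} * (ε * Q.holdingRate ξ)) := by
    rw [hg', integral_sub hg hindint, hg0, integral_indicator_const _ MeasurableSet.of_discrete,
      zero_sub, smul_eq_mul]
  have hμξ : 0 < μ.real {ξ} := ENNReal.toReal_pos (Q.measure_singleton_ne_zero hrec hirr hμ ξ)
    (measure_ne_top _ _)
  -- The `μ`-mean grows linearly in `s` while Dynkin's bound does not depend on `s`, so the slope
  -- must vanish.
  have hgrow : ∀ s : ℝ, 0 ≤ s → s * |μ.real {ξ} * (ε * Q.holdingRate ξ)| ≤ 2 * C.toReal := by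
    intro s hs
    have h1 := norm_integral_le_of_norm_le_const (μ := μ)
      (f := fun η => Q.expTimeIntegral g' s η) (Filter.Eventually.of_forall (hbound s hs))
    rw [Q.integral_expTimeIntegral hrec hirr hμ hg'int hs, hint'] at h1
    simpa [abs_of_nonneg hs] using h1
  have hε0 : ε = 0 := by
    by_contra hne
    have hpos : 0 < |μ.real {ξ} * (ε * Q.holdingRate ξ)| :=
      abs_pos.2 (mul_ne_zero hμξ.ne' (mul_ne_zero hne hξ.ne'))
    have h2 := hgrow ((2 * C.toReal + 1) / |μ.real {ξ} * (ε * Q.holdingRate ξ)|)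
      (div_nonneg (by positivity) hpos.le)
    rw [div_mul_cancel₀ _ hpos.ne'] at h2
    linarith
  have hgg : g' = g := by
    funext x
    simp [hg', hε0]
  rw [hgg] at hbound
  refine iSup_le fun η => ?_
  calc ENNReal.ofReal |Q.expTimeIntegral g t η| ≤ ENNReal.ofReal (2 * C.toReal) :=
        ENNReal.ofReal_le_ofReal (hbound t ht.le η)
    _ = 2 * C := by
        rw [ENNReal.ofReal_mul two_pos.le, ENNReal.ofReal_toReal hCt, ENNReal.ofReal_ofNat]

end Invariant

end TransitionRates

/-! ### Centering on the blocks of a partition. -/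

section Partition

variable {E : Type*} [Countable E] [MeasurableSpace E] [DiscreteMeasurableSpace E]
  {μ : Measure E} [IsProbabilityMeasure μ] {g : E → ℝ}

theorem centeredOn_eq (μ : Measure E) (B : Set E) (g : E → ℝ) :
    centeredOn μ B g = fun η =>
      B.indicator g η - B.indicator (fun _ => ∫ ζ, g ζ ∂(cond μ B)) η := by
  funext η
  by_cases h : η ∈ B <;> simp [centeredOn, h]

theorem integrable_centeredOn (hg : Integrable g μ) (B : Set E) :
    Integrable (centeredOn μ B g) μ := by
  rw [centeredOn_eq]
  exact (hg.indicator MeasurableSet.of_discrete).sub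
    ((integrable_const _).indicator MeasurableSet.of_discrete)

theorem integral_centeredOn (hg : Integrable g μ) {B : Set E} (hB : μ B ≠ 0) :
    ∫ η, centeredOn μ B g η ∂μ = 0 := by
  rw [centeredOn_eq, integral_sub (hg.indicator MeasurableSet.of_discrete)
    ((integrable_const _).indicator MeasurableSet.of_discrete),
    integral_indicator MeasurableSet.of_discrete,
    integral_indicator_const _ MeasurableSet.of_discrete, ProbabilityTheory.cond, integral_smul_measure,
    smul_eq_mul, smul_eq_mul, ENNReal.toReal_inv, Measure.real, mul_inv_cancel_left₀, sub_self]
  exact (ENNReal.toReal_pos hB (measure_ne_top _ _)).ne'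

theorem sub_partitionCondExp_eq_sum {S : Type*} [Fintype S] {A : S → Set E}
    (hdisj : Pairwise fun x y => Disjoint (A x) (A y)) (hcov : (⋃ x, A x) = Set.univ) (ζ : E) :
    g ζ - partitionCondExp μ A g ζ = ∑ x, centeredOn μ (A x) g ζ := by
  classical
  simp_rw [centeredOn_eq, Finset.sum_sub_distrib]
  congr 1
  obtain ⟨x, hx⟩ := Set.mem_iUnion.1 (hcov ▸ Set.mem_univ ζ : ζ ∈ ⋃ x, A x)
  rw [Finset.sum_eq_single x (fun y _ hy => Set.indicator_of_notMem
    (fun h => Set.disjoint_left.1 (hdisj hy) h hx) _) (by simp), Set.indicator_of_mem hx]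

end Partition

theorem TransitionRates.expTimeIntegral_sum {E S : Type*} [Countable E] [MeasurableSpace E]
    [DiscreteMeasurableSpace E] [Fintype S] (Q : TransitionRates E) {h : S → E → ℝ} {t : ℝ}
    (ht : 0 ≤ t) {η : E} (hint : ∀ x, Q.TimeIntegrable (h x) t η) :
    Q.TimeIntegrable (fun ζ => ∑ x, h x ζ) t η ∧
      Q.expTimeIntegral (fun ζ => ∑ x, h x ζ) t η = ∑ x, Q.expTimeIntegral (h x) t η := by
  have hs : Q.TimeIntegrable (fun ζ => ∑ x, h x ζ) t η :=
    integrable_finsetSum _ fun x _ => hint x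
  refine ⟨hs, ?_⟩
  rw [Q.expTimeIntegral_eq_integral_prod ht hs, integral_finsetSum _ fun x _ => hint x]
  exact Finset.sum_congr rfl fun x _ => (Q.expTimeIntegral_eq_integral_prod ht (hint x)).symm

end

/-! ### The lemma and its corollary. -/

theorem lemma6p4 {E : Type*} [Countable E] [MeasurableSpace E] [DiscreteMeasurableSpace E]
    (Q : TransitionRates E) (hirr : Q.IsIrreducible) (hrec : Q.IsRecurrent)
    (hpos : Q.HasFiniteMeanReturnTimes)
    (μ : Measure E) [IsProbabilityMeasure μ] (hμ : Q.IsInvariant μ) :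
    (∀ (g : E → ℝ) (ξ : E), Integrable g μ → ∫ η, g η ∂μ = 0 → g ξ ≠ 0 →
      ∀ t : ℝ, 0 < t →
        (∀ η, Q.TimeIntegrable g t η) ∧
        (⨆ η, ENNReal.ofReal |Q.expTimeIntegral g t η|) ≤
          2 * ⨆ η ∈ {η | g η ≠ 0}, Q.expAbsIntegralUntilHit g ξ η) ∧
    (∀ (S : Type*) [Fintype S] (A : S → Set E) (ξ : S → E),
      Pairwise (fun x y => Disjoint (A x) (A y)) → (⋃ x, A x) = Set.univ → (∀ x, ξ x ∈ A x) →
      ∀ g : E → ℝ, Integrable g μ → ∀ t : ℝ, 0 < t →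
        (∀ η, Q.TimeIntegrable (fun ζ => g ζ - partitionCondExp μ A g ζ) t η) ∧
        (⨆ η, ENNReal.ofReal
            |Q.expTimeIntegral (fun ζ => g ζ - partitionCondExp μ A g ζ) t η|) ≤
          2 * ∑ x, ⨆ η ∈ A x, Q.expAbsIntegralUntilHit (centeredOn μ (A x) g) (ξ x) η) := by
  refine ⟨fun g ξ hg hg0 _ t ht => ⟨fun η => Q.timeIntegrable hrec hirr hμ hg t η,
    Q.iSup_abs_expTimeIntegral_le hrec hirr hμ hg hg0 ξ (fun η h => h) ht⟩, ?_⟩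
  intro S _ A ξ hdisj hcov hξ g hg t ht
  have hint := fun η x => Q.timeIntegrable hrec hirr hμ (integrable_centeredOn hg (A x)) t η
  -- The centered function may vanish at `ξ x`, so the version with an arbitrary reference state is
  -- used, with the block in place of the support. The block has positive mass because it contains
  -- `ξ x`.
  have hblock : ∀ x, (⨆ η, ENNReal.ofReal |Q.expTimeIntegral (centeredOn μ (A x) g) t η|) ≤
      2 * ⨆ η ∈ A x, Q.expAbsIntegralUntilHit (centeredOn μ (A x) g) (ξ x) η := fun x =>
    Q.iSup_abs_expTimeIntegral_le hrec hirr hμ (integrable_centeredOn hg (A x))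
      (integral_centeredOn hg fun h0 => Q.measure_singleton_ne_zero hrec hirr hμ (ξ x)
        (measure_mono_null (Set.singleton_subset_iff.2 (hξ x)) h0)) (ξ x)
      (fun η h => Set.mem_of_indicator_ne_zero h) ht
  rw [funext (sub_partitionCondExp_eq_sum (μ := μ) (g := g) hdisj hcov)]
  refine ⟨fun η => (Q.expTimeIntegral_sum ht.le (hint η)).1, iSup_le fun η => ?_⟩
  rw [(Q.expTimeIntegral_sum ht.le (hint η)).2, Finset.mul_sum]
  calc ENNReal.ofReal |∑ x, Q.expTimeIntegral (centeredOn μ (A x) g) t η|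
      ≤ ENNReal.ofReal (∑ x, |Q.expTimeIntegral (centeredOn μ (A x) g) t η|) :=
        ENNReal.ofReal_le_ofReal (Finset.abs_sum_le_sum_abs _ _)
    _ = ∑ x, ENNReal.ofReal |Q.expTimeIntegral (centeredOn μ (A x) g) t η| :=
        ENNReal.ofReal_sum_of_nonneg fun x _ => abs_nonneg _
    _ ≤ _ := Finset.sum_le_sum fun x _ =>
        (le_iSup (fun η => ENNReal.ofReal |Q.expTimeIntegral (centeredOn μ (A x) g) t η|) η).trans
          (hblock x)
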